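/- Let $\kappa$ be a field, $X$ a compact ANR, $\xi\in H^1(X;\mathbb R)=\mathrm{Hom}(H_1(X;\mathbb Z),\mathbb R)$, and $\Gamma=\xi(H_1(X;\mathbb Z))\subset\mathbb R$. Let $\pi:\tilde X\to X$ be the principal $\Gamma$-covering associated with $\xi$, and let $f:\tilde X\to\mathbb R$ be a lift of a topological closed 1-form in the class $\xi$, i.e. a continuous map with $f(g\cdot x)=f(x)+g$ for $g\in\Gamma$, $x\in\tilde X$. For $t\in\mathbb R$ put $\tilde X_t=f^{-1}((-\infty,t])$; let $H_r$ be singular homology with coefficients in $\kappa$, let $i_s^t:H_r(\tilde X_s)\to H_r(\tilde X_t)$ ($s\le t$) be induced by inclusion, and let $\mathbb I_t=\mathrm{img}(H_r(\tilde X_t)\to H_r(\tilde X))$. For $r\ge 0$ and $a\in\mathbb R$ consider the commutative diagram $$\begin{array}{ccccc}\varprojlim_{t<a}H_r(\tilde X_t)&\to&H_r(\tilde X_a)&\to&\varinjlim_{t>a}H_r(\tilde X_t)\\ \downarrow&&\downarrow&&\downarrow\\ \bigcap_{t\in\mathbb R}\mathbb I_t&\to&\mathbb I_a&\to&\bigcup_{t\in\mathbb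 R}\mathbb I_t\end{array}\qquad(*)$$ in which the limits are taken with respect to the maps $i_s^t$, all maps in the upper row and all vertical maps are the canonical ones induced by inclusions of spaces, and the lower row consists of inclusions. Then the left and the right vertical arrows of $(*)$ are isomorphisms. More precisely, for every $l\in\Gamma$ with $l>0$ there are subspaces $V,W\subset H_r(\tilde X_a)$ (depending on $l$) with $H_r(\tilde X_a)=V\oplus W$, and an injective linear map $\alpha:V\to V$, such that $\alpha=p_V\circ i_{a-l}^a\circ\mu_{-l}|_V$, where $p_V:V\oplus W\to V$ is the projection and $\mu_{-l}:H_r(\tilde X_a)\to H_r(\tilde X_{a-l})$ is induced by the action of $-l$, and such that $(*)$ is isomorphic, by an isomorphism which at $H_r(\tilde X_a)=V\oplus W$ is this identification, to the diagram $$\begin{array}{ccccc}\bigcap_{k\ge 0}\alpha^k(V)&\to&V\oplus W&\to&\overline V\\ \downarrow{\scriptstyle\mathrm{id}}&&\downarrow{\scriptstyle p_V}&&\downarrow{\scriptstyle\mathrm{id}}\\ \bigcap_{k\ge 0}\alpha^k(V)&\to&V&\to&\overline V\end{array}$$ Here $\overline V=\varinjlim(V\xrightarrow{\alpha}V\xrightarrow{\alpha}V\to\cdots)$,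 the two left horizontal arrows are the inclusions (the upper one into $V\oplus 0$), the lower right arrow is the canonical map from the first copy of $V$ into the limit (injective, as $\alpha$ is), and the upper right arrow is its composition with $p_V$. -/

import Mathlib

open CategoryTheory

universe u v

noncomputable section

namespace TopForm

/-! ### Spaces and singular homology -/

/-- `X` is an absolute neighbourhood retract (for metrizable spaces): `X` is metrizable, and
whenever `X` is embedded as a closed subset of a metrizable space `Y`, some neighbourhood of the
image retracts onto it. -/
def IsANR (X : Type u) [TopologicalSpace X] : Prop :=
  TopologicalSpace.MetrizableSpace X ∧
    ∀ (Y : Type u) [TopologicalSpace Y] [TopologicalSpace.MetrizableSpace Y] (i : X → Y),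
      Topology.IsClosedEmbedding i →
        ∃ U : Set Y, IsOpen U ∧ Set.range i ⊆ U ∧
          ∃ ρ : C(U, X), ∀ (x : X) (hx : i x ∈ U), ρ ⟨i x, hx⟩ = x

/-- The singular chain complex of `Y` with coefficients in the ring `R`. -/
abbrev Chains (R : Type v) [CommRing R] (Y : Type u) [TopologicalSpace Y] :
    ChainComplex (ModuleCat.{max u v} R) ℕ :=
  ((AlgebraicTopology.singularChainComplexFunctor (ModuleCat.{max u v} R)).obj
    (ModuleCat.of R (ULift.{u} R))).obj (TopCat.of Y)

/-- The singular homology `H_n(Y; R)`. -/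
abbrev H (R : Type v) [CommRing R] (n : ℕ) (Y : Type u) [TopologicalSpace Y] :
    ModuleCat.{max u v} R :=
  ((AlgebraicTopology.singularHomologyFunctor (ModuleCat.{max u v} R) n).obj
    (ModuleCat.of R (ULift.{u} R))).obj (TopCat.of Y)

/-- The linear map induced in singular homology by a continuous map. -/
def Hmap (R : Type v) [CommRing R] (n : ℕ) {Y Z : Type u} [TopologicalSpace Y]
    [TopologicalSpace Z] (φ : C(Y, Z)) : H R n Y →ₗ[R] H R n Z :=
  (((AlgebraicTopology.singularHomologyFunctor (ModuleCat.{max u v} R) n).obj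
    (ModuleCat.of R (ULift.{u} R))).map (TopCat.ofHom φ)).hom

theorem Hmap_comp_apply (R : Type v) [CommRing R] (n : ℕ) {Y Z T : Type u} [TopologicalSpace Y]
    [TopologicalSpace Z] [TopologicalSpace T] (ψ : C(Z, T)) (φ : C(Y, Z)) (x : H R n Y) :
    Hmap R n (ψ.comp φ) x = Hmap R n ψ (Hmap R n φ x) := by
  simp [Hmap, TopCat.ofHom_comp]

/-! ### The homology class of a loop -/

section Loop

variable {X : Type u} [TopologicalSpace X]

/-- A path as a singular 1-simplex: barycentric coordinates `(s₀, s₁)` are sent to `γ s₁`. -/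
def pathSimplex {x y : X} (γ : Path x y) : C(stdSimplex ℝ (Fin 2), X) where
  toFun s := γ.extend (s.1 1)
  continuous_toFun := γ.continuous_extend.comp ((continuous_apply 1).comp continuous_subtype_val)

/-- The same simplex, as an element of the singular simplicial set of `X`. -/
def pathSimplex' {x y : X} (γ : Path x y) :
    (TopCat.toSSet.obj (TopCat.of X)).obj (.op (SimplexCategory.mk 1)) :=
  (TopCat.toSSetObjEquiv (TopCat.of X) (.op (SimplexCategory.mk 1))).symm (pathSimplex γ)

/-- The chain `1 · γ`. -/
def pathChain {x y : X} (γ : Path x y) :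
    ModuleCat.of ℤ (ULift.{u} ℤ) ⟶ (Chains ℤ X).X 1 :=
  (TopCat.toSSet.obj (TopCat.of X)).ιChainComplex (pathSimplex' γ)

theorem pathSimplex'_faces {x : X} (γ : Path x x) :
    (TopCat.toSSet.obj (TopCat.of X)).δ 0 (pathSimplex' γ) =
      (TopCat.toSSet.obj (TopCat.of X)).δ 1 (pathSimplex' γ) := by
  apply (TopCat.toSSetObjEquiv (TopCat.of X) (.op (SimplexCategory.mk 0))).injective
  ext s
  change γ.extend ((stdSimplex.map (SimplexCategory.δ (n := 0) 0) s).1 1) =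
    γ.extend ((stdSimplex.map (SimplexCategory.δ (n := 0) 1) s).1 1)
  have hs : s = stdSimplex.vertex (0 : Fin 1) :=
    Subsingleton.elim (α := stdSimplex ℝ (Fin 1)) _ _
  have h0 : (stdSimplex.map (SimplexCategory.δ (n := 0) 0) s).1 1 = 1 := by
    rw [hs, stdSimplex.map_vertex]
    exact Pi.single_eq_same (M := fun _ : Fin 2 => ℝ) 1 1
  have h1 : (stdSimplex.map (SimplexCategory.δ (n := 0) 1) s).1 1 = 0 := by
    rw [hs, stdSimplex.map_vertex]
    exact Pi.single_eq_of_ne (M := fun _ : Fin 2 => ℝ) (by decide : (1 : Fin 2) ≠ 0) 1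
  rw [h0, h1, γ.extend_one, γ.extend_zero]

theorem pathChain_d {x : X} (γ : Path x x) : pathChain γ ≫ (Chains ℤ X).d 1 0 = 0 := by
  have h := SSet.ιChainComplex_d (TopCat.toSSet.obj (TopCat.of X))
    (R := ModuleCat.of ℤ (ULift.{u} ℤ)) (n := 0) (pathSimplex' γ)
  refine h.trans ?_
  simp [Fin.sum_univ_two, pathSimplex'_faces]
  rfl

/-- The class in `H_1(X; ℤ)` of a loop in `X`. -/
def loopClass {x : X} (γ : Path x x) : H ℤ 1 X :=
  ((Chains ℤ X).liftCycles (pathChain γ) 0 (by simp) (pathChain_d γ) ≫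
    (Chains ℤ X).homologyπ 1).hom (ULift.up 1)

end Loop

/-! ### The covering of a cohomology class, lifts of closed 1-forms -/

/-- Given `ξ ∈ H¹(X; ℝ) = Hom(H_1(X; ℤ), ℝ)`, with group of periods `Γ = ξ.range ⊆ ℝ`:
`π : X' → X` is the principal `Γ`-covering associated with `ξ`. That is, `Γ` acts on `X'` freely
and properly discontinuously with quotient map `π`, and a path in `X'` which lies over a loop `γ`
of `X` goes from its origin `p` to `ξ [γ] + p`. -/
structure IsAssociatedCovering {X X' : Type u} [TopologicalSpace X] [TopologicalSpace X']
    (ξ : H.{u, 0} ℤ 1 X →+ ℝ) [AddAction ξ.range X'] (π : C(X', X)) : Prop where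
  covering : IsAddQuotientCoveringMap π ξ.range
  monodromy : ∀ (p q : X') (γ : Path p q) (h : π q = π p),
    q = (⟨ξ (loopClass ((γ.map π.continuous).cast rfl h.symm)), AddMonoidHom.mem_range.2 ⟨_, rfl⟩⟩ :
      ξ.range) +ᵥ p

/-- `f : X' → ℝ` is a `Γ`-equivariant continuous map: a lift of a topological closed 1-form (the
latter being the class of `f` up to locally constant functions). -/
def IsLift {Γ : AddSubgroup ℝ} {X' : Type u} [TopologicalSpace X'] [AddAction Γ X']
    (f : C(X', ℝ)) : Prop :=
  ∀ (g : Γ) (x : X'), f (g +ᵥ x) = f x + g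

/-! ### Sublevel sets and the comparison diagram -/

section Sublevel

variable {X' : Type u} [TopologicalSpace X'] (f : C(X', ℝ))

/-- The sublevel set `X'_t = f⁻¹((-∞, t])`. -/
abbrev Sub (t : ℝ) : Type u := {x : X' // f x ≤ t}

/-- The inclusion `X'_s ⊆ X'_t` for `s ≤ t`. -/
def subIncl {s t : ℝ} (h : s ≤ t) : C(Sub f s, Sub f t) where
  toFun x := ⟨x.1, x.2.trans h⟩

/-- The inclusion `X'_t ⊆ X'`. -/
def subToAll (t : ℝ) : C(Sub f t, X') where
  toFun x := x.1

/-- The homeomorphism `X'_s → X'_{s+g}` given by the action of `g`. -/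
def subTranslate {Γ : AddSubgroup ℝ} [AddAction Γ X'] [ContinuousConstVAdd Γ X']
    (hf : IsLift (Γ := Γ) f) (g : Γ) (s : ℝ) : C(Sub f s, Sub f (s + g)) where
  toFun x := ⟨g +ᵥ x.1, (hf g x.1).trans_le (by linarith [x.2])⟩
  continuous_toFun := (continuous_subtype_val.const_vadd g).subtype_mk _

variable (κ : Type v) [Field κ] (r : ℕ)

/-- `i_s^t(r) : H_r(X'_s) → H_r(X'_t)`, induced by the inclusion. -/
def levelMap {s t : ℝ} (h : s ≤ t) : H κ r (Sub f s) →ₗ[κ] H κ r (Sub f t) :=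
  Hmap κ r (subIncl f h)

/-- `H_r(X'_t) → H_r(X')`, induced by the inclusion. -/
def toAll (t : ℝ) : H κ r (Sub f t) →ₗ[κ] H κ r X' :=
  Hmap κ r (subToAll f t)

theorem levelMap_levelMap {s t w : ℝ} (h : s ≤ t) (h' : t ≤ w) (x : H κ r (Sub f s)) :
    levelMap f κ r h' (levelMap f κ r h x) = levelMap f κ r (h.trans h') x :=
  (Hmap_comp_apply κ r (subIncl f h') (subIncl f h) x).symm

theorem toAll_levelMap {s t : ℝ} (h : s ≤ t) (x : H κ r (Sub f s)) :
    toAll f κ r t (levelMap f κ r h x) = toAll f κ r s x :=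
  (Hmap_comp_apply κ r (subToAll f t) (subIncl f h) x).symm

/-- `𝕀_t(r)`, the image of `H_r(X'_t) → H_r(X')`. -/
def img (t : ℝ) : Submodule κ (H κ r X') := LinearMap.range (toAll f κ r t)

theorem img_mono {s t : ℝ} (h : s ≤ t) : img f κ r s ≤ img f κ r t := by
  rintro _ ⟨x, rfl⟩
  exact ⟨levelMap f κ r h x, toAll_levelMap f κ r h x⟩

/-- `𝕀_{-∞}(r) = ⋂_t 𝕀_t(r)`. -/
def imgBot : Submodule κ (H κ r X') := ⨅ t : ℝ, img f κ r t

/-- `𝕀_∞(r) = ⋃_t 𝕀_t(r)`. -/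
def imgTop : Submodule κ (H κ r X') where
  carrier := ⋃ t : ℝ, (img f κ r t : Set (H κ r X'))
  zero_mem' := Set.mem_iUnion.2 ⟨0, zero_mem _⟩
  add_mem' := by
    intro x y hx hy
    obtain ⟨s, hs⟩ := Set.mem_iUnion.1 hx
    obtain ⟨t, ht⟩ := Set.mem_iUnion.1 hy
    exact Set.mem_iUnion.2 ⟨max s t, add_mem (img_mono f κ r (le_max_left s t) hs)
      (img_mono f κ r (le_max_right s t) ht)⟩
  smul_mem' := by
    intro c x hx
    obtain ⟨s, hs⟩ := Set.mem_iUnion.1 hx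
    exact Set.mem_iUnion.2 ⟨s, Submodule.smul_mem _ c hs⟩

theorem imgBot_le (a : ℝ) : imgBot f κ r ≤ img f κ r a := iInf_le _ a

theorem le_imgTop (a : ℝ) : img f κ r a ≤ imgTop f κ r :=
  Set.subset_iUnion (fun t : ℝ => (img f κ r t : Set (H κ r X'))) a

variable (a : ℝ)

/-- The inverse limit of the `H_r(X'_t)`, `t < a`, as the space of compatible families. -/
def invLim : Submodule κ (∀ t : Set.Iio a, H κ r (Sub f t)) where
  carrier := {x | ∀ (s t : Set.Iio a) (h : s ≤ t), levelMap f κ r h (x s) = x t}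
  zero_mem' := fun _ _ _ => map_zero _
  add_mem' := by
    intro x y hx hy s t h
    rw [Pi.add_apply, map_add, hx s t h, hy s t h, Pi.add_apply]
  smul_mem' := by
    intro c x hx s t h
    rw [Pi.smul_apply, map_smul, hx s t h, Pi.smul_apply]

open Classical in
/-- The direct limit of the `H_r(X'_t)`, `t > a`. -/
abbrev dirLim : Type (max u v) :=
  Module.DirectLimit (R := κ) (ι := Set.Ioi a) (fun t => H κ r (Sub f t))
    (fun _ _ h => levelMap f κ r h)

/-- Upper left arrow: a compatible family `(x_t)` is sent to `i_t^a(x_t)`, for any `t < a`. -/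
def invLimTo : invLim f κ r a →ₗ[κ] H κ r (Sub f a) :=
  levelMap f κ r (sub_one_lt a).le ∘ₗ LinearMap.proj (⟨a - 1, sub_one_lt a⟩ : Set.Iio a) ∘ₗ
    (invLim f κ r a).subtype

theorem invLimTo_eq (x : invLim f κ r a) (t : Set.Iio a) :
    invLimTo f κ r a x = levelMap f κ r (le_of_lt t.2) (x.1 t) := by
  change levelMap f κ r _ (x.1 (⟨a - 1, sub_one_lt a⟩ : Set.Iio a)) = _
  rcases le_total (⟨a - 1, sub_one_lt a⟩ : Set.Iio a) t with h | h
  · rw [← x.2 _ _ h, levelMap_levelMap]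
  · rw [← x.2 _ _ h, levelMap_levelMap]

open Classical in
/-- Upper right arrow: `x ∈ H_r(X'_a)` is sent to the class of `i_a^t(x)`, for any `t > a`. -/
def toDirLim : H κ r (Sub f a) →ₗ[κ] dirLim f κ r a :=
  Module.DirectLimit.of κ (Set.Ioi a) (fun t => H κ r (Sub f t))
    (fun _ _ h => levelMap f κ r h) ⟨a + 1, lt_add_one a⟩ ∘ₗ levelMap f κ r (lt_add_one a).le

open Classical in
theorem toDirLim_eq (x : H κ r (Sub f a)) (t : Set.Ioi a) :
    toDirLim f κ r a x = Module.DirectLimit.of κ (Set.Ioi a) (fun t => H κ r (Sub f t))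
      (fun _ _ h => levelMap f κ r h) t (levelMap f κ r (le_of_lt t.2) x) := by
  change Module.DirectLimit.of κ (Set.Ioi a) (fun t => H κ r (Sub f t))
    (fun _ _ h => levelMap f κ r h) ⟨a + 1, lt_add_one a⟩ (levelMap f κ r _ x) = _
  rcases le_total (⟨a + 1, lt_add_one a⟩ : Set.Ioi a) t with h | h
  · rw [← levelMap_levelMap f κ r (lt_add_one a).le h x]
    exact (Module.DirectLimit.of_f (hij := h)).symm
  · rw [← levelMap_levelMap f κ r (le_of_lt t.2) h x]
    exact Module.DirectLimit.of_f (hij := h)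

/-- Left vertical arrow: a compatible family is sent to the common image of its members. -/
def leftArrow : invLim f κ r a →ₗ[κ] imgBot f κ r :=
  (toAll f κ r a ∘ₗ invLimTo f κ r a).codRestrict (imgBot f κ r) fun x => by
    refine (Submodule.mem_iInf _).2 fun t => ?_
    rw [LinearMap.comp_apply,
      invLimTo_eq f κ r a x ⟨min t (a - 1), (min_le_right _ _).trans_lt (sub_one_lt a)⟩,
      toAll_levelMap]
    exact img_mono f κ r (min_le_left t (a - 1)) ⟨_, rfl⟩

/-- Middle vertical arrow. -/
def middleArrow : H κ r (Sub f a) →ₗ[κ] img f κ r a := (toAll f κ r a).rangeRestrict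

open Classical in
/-- The map from the direct limit induced by the maps `H_r(X'_t) → H_r(X')`. -/
def dirLimToAll : dirLim f κ r a →ₗ[κ] H κ r X' :=
  Module.DirectLimit.lift κ (Set.Ioi a) (fun t => H κ r (Sub f t))
    (fun _ _ h => levelMap f κ r h) (fun t => toAll f κ r t)
    (fun _ _ h x => toAll_levelMap f κ r h x)

open Classical in
/-- Right vertical arrow. -/
def rightArrow : dirLim f κ r a →ₗ[κ] imgTop f κ r :=
  (dirLimToAll f κ r a).codRestrict (imgTop f κ r) fun z => by
    have : Nonempty (Set.Ioi a) := ⟨⟨a + 1, lt_add_one a⟩⟩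
    obtain ⟨t, x, rfl⟩ := Module.DirectLimit.exists_of z
    rw [dirLimToAll, Module.DirectLimit.lift_of]
    exact le_imgTop f κ r t ⟨x, rfl⟩

end Sublevel

/-! ### The algebraic model of the diagram -/

section Model

variable {κ : Type v} [Field κ] {V : Type*} [AddCommGroup V] [Module κ V] (α : V →ₗ[κ] V)

/-- `⋂_k α^k(V)`. (Negative `k`, i.e. preimages of `V`, would contribute nothing.) -/
def core : Submodule κ V := ⨅ k : ℕ, LinearMap.range (α ^ k)

/-- The direct limit of `V → V → V → ⋯`, all maps being `α`. -/
abbrev telescope : Type _ :=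
  Module.DirectLimit (R := κ) (ι := ℕ) (fun _ => V) (fun i j _ => α ^ (j - i))

/-- The canonical map `V → lim (V → V → V → ⋯)`, from the first copy of `V`. -/
def toTelescope : V →ₗ[κ] telescope α :=
  Module.DirectLimit.of κ ℕ (fun _ => V) (fun i j _ => α ^ (j - i)) 0

end Model

/-- The comparison diagram

  `lim H_r(X'_t) ⟶ H_r(X'_a) ⟶ colim H_r(X'_t)`
  `      ↓              ↓              ↓      `
  ` ⋂_t 𝕀_t(r)  ⟶   𝕀_a(r)   ⟶  ⋃_t 𝕀_t(r) `

is isomorphic to the diagram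

  `⋂_k α^k(V) ⟶ V ⊕ W ⟶ lim_α V`
  `     ↓ id      ↓ p_V     ↓ id  `
  `⋂_k α^k(V) ⟶   V   ⟶ lim_α V`

where `H_r(X'_a) = V ⊕ W` is an internal direct sum and the isomorphism is the resulting
identification at the place `H_r(X'_a)`. The fields `upper_left`, …, `right` are the compatibility
with the seven arrows. -/
structure ModelIso {X' : Type u} [TopologicalSpace X'] (f : C(X', ℝ)) (κ : Type v) [Field κ]
    (r : ℕ) (a : ℝ) (V W : Submodule κ (H κ r (Sub f a))) (hVW : IsCompl V W)
    (α : V →ₗ[κ] V) where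
  /-- upper left objects -/
  eLim : invLim f κ r a ≃ₗ[κ] core α
  /-- upper right objects -/
  eColim : dirLim f κ r a ≃ₗ[κ] telescope α
  /-- lower left objects -/
  eBot : imgBot f κ r ≃ₗ[κ] core α
  /-- lower middle objects -/
  eImg : img f κ r a ≃ₗ[κ] V
  /-- lower right objects -/
  eTop : imgTop f κ r ≃ₗ[κ] telescope α
  upper_left : ∀ x, (V.prodEquivOfIsCompl W hVW).symm (invLimTo f κ r a x) = ((eLim x : V), 0)
  upper_right : ∀ y, eColim (toDirLim f κ r a y) = toTelescope α (V.projectionOnto W hVW y)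
  lower_left : ∀ x, eImg (Submodule.inclusion (imgBot_le f κ r a) x) = (eBot x : V)
  lower_right : ∀ x, eTop (Submodule.inclusion (le_imgTop f κ r a) x) = toTelescope α (eImg x)
  left : ∀ x, eBot (leftArrow f κ r a x) = eLim x
  middle : ∀ y, eImg (middleArrow f κ r a y) = V.projectionOnto W hVW y
  right : ∀ z, eTop (rightArrow f κ r a z) = eColim z

/-- For `l ≥ 0` in `Γ`, the endomorphism `i_{a-l}^a(r) ∘ μ_{-l}(r)` of `H_r(X'_a)`, where
`μ_{-l} : X'_a → X'_{a-l}` is the action of `-l`. -/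
def shiftBack {X' : Type u} [TopologicalSpace X'] {Γ : AddSubgroup ℝ} [AddAction Γ X']
    (hc : ContinuousConstVAdd Γ X') (f : C(X', ℝ)) (hf : IsLift (Γ := Γ) f) (κ : Type v)
    [Field κ] (r : ℕ) (a : ℝ) (l : Γ) (hl : 0 ≤ (l : ℝ)) : H κ r (Sub f a) →ₗ[κ] H κ r (Sub f a) :=
  levelMap f κ r (show a + ((-l : Γ) : ℝ) ≤ a by simpa using hl) ∘ₗ
    Hmap κ r (subTranslate f hf (-l) a)

end TopForm

end

noncomputable section

namespace TopForm

/-! Everything follows from one uniform estimate (`DiesAfter`): there is a constant `N` such that a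
class of any sublevel set which dies in `H_r(X')` already dies after the level is raised by `N`. The
kernels of the maps to `H_r(X')` are then invisible to the inverse and the direct limit, so the
outer vertical arrows are isomorphisms. In particular the image of the inverse limit meets the
kernel `W` of `H_r(X'_a) → H_r(X')` trivially, so `W` has a complement `V` containing that image.
Since `V` maps isomorphically onto `𝕀_a`, the compression `α` of the shift to `V` becomes the action
of `-l` on `𝕀_a`, which is injective. The translates of `𝕀_a` by multiples of `l` are cofinal among
the `𝕀_t` in both directions, so their intersection is the core of `α` and their union is its
telescope (`mem_imgBot_iff`, `mem_imgTop_iff`, `modelIso`).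

The estimate (`exists_uniform_bound`) is proved on chains. A compact ANR is a retract of an open set
in a normed space. Hence fine simplices of `X'` can be straightened, with `f` varying by at most
`1`, to simplices lying over a finite set of simplices of `X` (`exists_small_chains`,
`exists_straightening`). Chains over such a finite set form finite free modules over the group ring
`κ[Γ]`, on which level and degree agree up to a constant (`exists_bounded_of_finite`). It remains to
see that a matrix over `κ[Γ]` is strict for the degree filtration up to a constant
(`exists_strict`). This holds because `Γ ⊆ ℝ` is totally ordered and Archimedean: a non-zero element
is its leading term, a unit, times `1 - q` with `q` of negative degree. -/

theorem lsum_nat_single {κ ι M : Type*} [CommRing κ] [AddCommGroup M] [Module κ M]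
    (f : ι → κ →ₗ[κ] M) (i : ι) (a : κ) : Finsupp.lsum ℕ f (Finsupp.single i a) = f i a :=
  Finsupp.lsum_single ℕ f i a

/-! ### Singular chains as finitely supported functions, and their homology classes -/

section Concrete
variable (κ : Type v) [CommRing κ] (n : ℕ) (Y : Type u) [TopologicalSpace Y]

/-- The standard topological simplex of dimension `n`. -/
abbrev Spx (n : ℕ) : Type := stdSimplex ℝ (Fin (n + 1))

/-- Singular chains as finitely supported functions on singular simplices. -/
abbrev Ch : Type (max u v) := C(Spx n, Y) →₀ κ

/-- The singular simplicial set. -/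
abbrev Sing : SSet.{u} := TopCat.toSSet.obj (TopCat.of Y)

/-- The complex `Chains κ Y`, presented as the chain complex of a simplicial set. -/
abbrev SCh : ChainComplex (ModuleCat.{max u v} κ) ℕ :=
  (Sing Y).chainComplex (ModuleCat.of κ (ULift.{u} κ))

variable {Y} {n} in
/-- The chain `1 · σ`, as a map from the coefficients. -/
def toChSimplex (x : (Sing Y).obj (.op (SimplexCategory.mk n))) :
    ModuleCat.of κ (ULift.{u} κ) ⟶ ModuleCat.of κ (Ch κ n Y) :=
  ModuleCat.ofHom (Finsupp.lsingle (TopCat.toSSetObjEquiv (TopCat.of Y) (.op (SimplexCategory.mk n)) x) ∘ₗ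
    ULift.moduleEquiv.toLinearMap)

/-- Comparison from Mathlib's singular chains to finitely supported functions. -/
def toCh : (SCh κ Y).X n ⟶ ModuleCat.of κ (Ch κ n Y) :=
  Limits.Cofan.IsColimit.desc ((Sing Y).isColimitChainComplexXCofan
    (ModuleCat.of κ (ULift.{u} κ)) n) (toChSimplex κ)

theorem ι_toCh (x : (Sing Y).obj (.op (SimplexCategory.mk n))) :
    (Sing Y).ιChainComplex x ≫ toCh κ n Y = toChSimplex κ x :=
  Limits.Cofan.IsColimit.fac _ _ _

/-- The inverse comparison. -/
def fromCh : ModuleCat.of κ (Ch κ n Y) ⟶ (SCh κ Y).X n :=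
  ModuleCat.ofHom (Finsupp.lsum ℕ fun σ =>
    ((Sing Y).ιChainComplex (R := ModuleCat.of κ (ULift.{u} κ))
      ((TopCat.toSSetObjEquiv (TopCat.of Y) (.op (SimplexCategory.mk n))).symm σ)).hom ∘ₗ
      ULift.moduleEquiv.symm.toLinearMap)

theorem toChSimplex_fromCh
    (x : (Sing Y).obj (.op (SimplexCategory.mk n))) :
    toChSimplex κ x ≫ fromCh κ n Y = (Sing Y).ιChainComplex x := by
  apply ModuleCat.hom_ext
  refine LinearMap.ext fun a => ?_
  refine (lsum_nat_single _ _ _).trans ?_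
  rw [Equiv.symm_apply_apply]
  rfl

theorem toCh_fromCh : toCh κ n Y ≫ fromCh κ n Y = 𝟙 _ := by
  apply SSet.chainComplex_hom_ext
  intro x
  rw [← Category.assoc, ι_toCh, toChSimplex_fromCh, Category.comp_id]

theorem fromCh_toCh : fromCh κ n Y ≫ toCh κ n Y = 𝟙 _ := by
  apply ModuleCat.hom_ext
  refine Finsupp.lhom_ext fun σ a => ?_
  have := ι_toCh κ n Y ((TopCat.toSSetObjEquiv (TopCat.of Y) (.op (SimplexCategory.mk n))).symm σ)
  have h := congrArg (fun f => f.hom (ULift.up a)) this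
  refine (congrArg (toCh κ n Y).hom (lsum_nat_single _ _ _)).trans (h.trans ?_)
  change Finsupp.single _ _ = Finsupp.single _ _
  rw [Equiv.apply_symm_apply]
  rfl

/-- The `i`-th face inclusion. -/
def face {n : ℕ} (i : Fin (n + 2)) : C(Spx n, Spx (n + 1)) :=
  ⟨stdSimplex.map i.succAbove, stdSimplex.continuous_map _⟩

/-- The singular boundary operator. -/
def bd : Ch κ (n + 1) Y →ₗ[κ] Ch κ n Y :=
  ∑ i : Fin (n + 2), ((-1 : ℤ) ^ (i : ℕ)) • Finsupp.lmapDomain κ κ fun σ => σ.comp (face i)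

theorem toCh_bd : toCh κ (n + 1) Y ≫ ModuleCat.ofHom (bd κ n Y) =
    (SCh κ Y).d (n + 1) n ≫ toCh κ n Y := by
  apply SSet.chainComplex_hom_ext
  intro x
  rw [← Category.assoc, ι_toCh, ← Category.assoc, SSet.ιChainComplex_d, Preadditive.sum_comp]
  simp_rw [Preadditive.zsmul_comp, ι_toCh]
  apply ModuleCat.hom_ext
  refine LinearMap.ext fun a => ?_
  simp [toChSimplex, bd, ModuleCat.hom_sum, LinearMap.sum_apply, Finsupp.mapDomain_single]
  rfl

variable {Y} in
/-- The map induced on chains by a continuous map. -/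
def push {n : ℕ} {Z : Type*} [TopologicalSpace Z] (φ : C(Y, Z)) : Ch κ n Y →ₗ[κ] Ch κ n Z :=
  Finsupp.lmapDomain κ κ fun σ => φ.comp σ

variable {Y} {n} in
theorem toCh_push {Z : Type u} [TopologicalSpace Z] (φ : C(Y, Z)) :
    toCh κ n Y ≫ ModuleCat.ofHom (push κ φ) =
    (SSet.chainComplexMap (TopCat.toSSet.map (TopCat.ofHom φ))
      (ModuleCat.of κ (ULift.{u} κ))).f n ≫ toCh κ n Z := by
  apply SSet.chainComplex_hom_ext
  intro x
  rw [← Category.assoc, ι_toCh, ← Category.assoc, SSet.ι_chainComplexMap_f, ι_toCh]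
  apply ModuleCat.hom_ext
  refine LinearMap.ext fun a => ?_
  refine (Finsupp.mapDomain_single).trans ?_
  rfl

variable {κ n Y}

theorem fromCh_hom_toCh (z : (SCh κ Y).X n) : (fromCh κ n Y).hom ((toCh κ n Y).hom z) = z :=
  congrArg (fun f => f.hom z) (toCh_fromCh κ n Y)

theorem toCh_hom_fromCh (z : Ch κ n Y) : (toCh κ n Y).hom ((fromCh κ n Y).hom z) = z :=
  congrArg (fun f => f.hom z) (fromCh_toCh κ n Y)

theorem toCh_d (z : (SCh κ Y).X (n + 1)) :
    (toCh κ n Y).hom (((SCh κ Y).d (n + 1) n).hom z) = bd κ n Y ((toCh κ (n + 1) Y).hom z) :=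
  (congrArg (fun f => f.hom z) (toCh_bd κ n Y)).symm

theorem bd_bd (z : Ch κ (n + 2) Y) : bd κ n Y (bd κ (n + 1) Y z) = 0 := by
  rw [← toCh_hom_fromCh z, ← toCh_d, ← toCh_d]
  have : ((SCh κ Y).d (n + 2) (n + 1) ≫ (SCh κ Y).d (n + 1) n).hom ((fromCh κ (n + 2) Y).hom z) = 0 := by
    rw [HomologicalComplex.d_comp_d]; rfl
  exact (congrArg _ this).trans (map_zero _)

/-- The chain `z` is a cycle. -/
def IsCyc : {n : ℕ} → Ch κ n Y → Prop
  | 0, _ => True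
  | n + 1, z => bd κ n Y z = 0

theorem isCyc_bd (z : Ch κ (n + 1) Y) : IsCyc (bd κ n Y z) := by
  cases n with
  | zero => trivial
  | succ n => exact bd_bd z

/-- The cycle `z` represents the homology class `x`. -/
def Rep (z : Ch κ n Y) (x : H κ n Y) : Prop :=
  ∃ c : (SCh κ Y).cycles n, (toCh κ n Y).hom (((SCh κ Y).iCycles n).hom c) = z ∧
    ((SCh κ Y).homologyπ n).hom c = x

theorem exists_rep (x : H κ n Y) : ∃ z : Ch κ n Y, Rep z x := by
  obtain ⟨c, hc⟩ := (ModuleCat.epi_iff_surjective ((SCh κ Y).homologyπ n)).1 inferInstance x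
  exact ⟨_, c, rfl, hc⟩

theorem IsCyc.exists_rep {z : Ch κ n Y} (h : IsCyc z) : ∃ x : H κ n Y, Rep z x := by
  have key : ((SCh κ Y).d n ((ComplexShape.down ℕ).next n)).hom ((fromCh κ n Y).hom z) = 0 := by
    cases n with
    | zero => 
      rw [HomologicalComplex.shape]
      · rfl
      · simp
    | succ n =>
      rw [ChainComplex.next_nat_succ]
      apply (ModuleCat.mono_iff_injective (toCh κ n Y)).1
      · exact (⟨⟨fromCh κ n Y, toCh_fromCh κ n Y, fromCh_toCh κ n Y⟩⟩ : IsIso (toCh κ n Y)).mono_of_iso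
      · rw [toCh_d, toCh_hom_fromCh, map_zero]
        exact h
  have ex := ShortComplex.exact_of_f_is_kernel
    (ShortComplex.mk ((SCh κ Y).iCycles n) ((SCh κ Y).d n _) (by simp))
    ((SCh κ Y).cyclesIsKernel n _ rfl)
  obtain ⟨c, hc⟩ := (ShortComplex.moduleCat_exact_iff _).1 ex _ key
  refine ⟨_, c, ?_, rfl⟩
  exact (congrArg _ hc).trans (toCh_hom_fromCh z)

/-- With `exists_rep` and `IsCyc.exists_rep` this translates vanishing in homology into solving `bd
w = z`, so that later arguments can stay with explicit chains. -/
theorem Rep.eq_zero_iff {z : Ch κ n Y} {x : H κ n Y} (h : Rep z x) :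
    x = 0 ↔ ∃ w, bd κ n Y w = z := by
  obtain ⟨c, rfl, rfl⟩ := h
  have ex := ShortComplex.exact_of_g_is_cokernel
    (ShortComplex.mk ((SCh κ Y).toCycles (n + 1) n) ((SCh κ Y).homologyπ n) (by simp))
    ((SCh κ Y).homologyIsCokernel (n + 1) n (by simp))
  have hi (w : (SCh κ Y).X (n + 1)) : ((SCh κ Y).iCycles n).hom (((SCh κ Y).toCycles (n + 1) n).hom w) =
      ((SCh κ Y).d (n + 1) n).hom w :=
    congrArg (fun f => f.hom w) ((SCh κ Y).toCycles_i (n + 1) n)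
  constructor
  · intro h0
    obtain ⟨w, hw⟩ := (ShortComplex.moduleCat_exact_iff _).1 ex c h0
    refine ⟨(toCh κ (n + 1) Y).hom w, ?_⟩
    rw [← toCh_d, ← hi]
    exact congrArg _ (congrArg _ hw)
  · rintro ⟨w, hw⟩
    rw [← toCh_hom_fromCh w, ← toCh_d, ← hi] at hw
    have h1 := congrArg (fromCh κ n Y).hom hw
    rw [fromCh_hom_toCh, fromCh_hom_toCh] at h1
    have h2 := (ModuleCat.mono_iff_injective ((SCh κ Y).iCycles n)).1 inferInstance h1
    rw [← h2]
    exact congrArg (fun f => f.hom ((fromCh κ (n + 1) Y).hom w))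
      ((SCh κ Y).toCycles_comp_homologyπ (n + 1) n)

theorem Rep.map {Z : Type u} [TopologicalSpace Z] (φ : C(Y, Z)) {z : Ch κ n Y} {x : H κ n Y}
    (h : Rep z x) : Rep (push κ φ z) (Hmap κ n φ x) := by
  obtain ⟨c, rfl, rfl⟩ := h
  let Φ := SSet.chainComplexMap (TopCat.toSSet.map (TopCat.ofHom φ)) (ModuleCat.of κ (ULift.{u} κ))
  refine ⟨(HomologicalComplex.cyclesMap Φ n).hom c, ?_, ?_⟩
  · have h1 := congrArg (fun f => f.hom c) (HomologicalComplex.cyclesMap_i Φ n)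
    have h2 := congrArg (fun f => f.hom (((SCh κ Y).iCycles n).hom c)) (toCh_push κ (n := n) φ)
    exact (congrArg _ h1).trans h2.symm
  · exact (congrArg (fun f => f.hom c) (HomologicalComplex.homologyπ_naturality Φ n)).symm

theorem push_bd {Z : Type*} [TopologicalSpace Z] (φ : C(Y, Z)) (z : Ch κ (n + 1) Y) :
    push κ φ (bd κ n Y z) = bd κ n Z (push κ φ z) := by
  simp only [push, bd, LinearMap.sum_apply, LinearMap.smul_apply, map_sum, map_zsmul]
  refine Finset.sum_congr rfl fun i _ => ?_
  congr 1
  simp only [Finsupp.lmapDomain_apply, ← Finsupp.mapDomain_comp]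
  rfl

theorem Rep.sub {z w : Ch κ n Y} {x y : H κ n Y} (h : Rep z x) (h' : Rep w y) :
    Rep (z - w) (x - y) := by
  obtain ⟨c, rfl, rfl⟩ := h
  obtain ⟨d, rfl, rfl⟩ := h'
  exact ⟨c - d, by simp only [map_sub], by simp only [map_sub]; rfl⟩

theorem Hmap_eq_of_homotopy {Z : Type u} [TopologicalSpace Z] {φ ψ : C(Y, Z)} (h : φ.Homotopy ψ)
    (x : H κ n Y) : Hmap κ n φ x = Hmap κ n ψ x := by
  have := TopCat.Homotopy.congr_homologyMap_singularChainComplexFunctor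
    (f := TopCat.ofHom φ) (g := TopCat.ofHom ψ) h (ModuleCat.of κ (ULift.{u} κ)) n
  exact congrArg (fun f => f.hom x) this

/-- Homotopic maps send a cycle to homologous cycles. -/
theorem exists_bd_eq_push_sub_push {Z : Type u} [TopologicalSpace Z] {φ ψ : C(Y, Z)}
    (h : φ.Homotopy ψ) {z : Ch κ n Y} (hz : IsCyc z) :
    ∃ w, bd κ n Z w = push κ φ z - push κ ψ z := by
  obtain ⟨x, hx⟩ := hz.exists_rep
  refine ((hx.map φ).sub (hx.map ψ)).eq_zero_iff.1 ?_
  rw [Hmap_eq_of_homotopy h, sub_self]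

end Concrete

/-! ### Natural operators on chains, acyclic models, prisms -/

section Operators

variable {κ : Type v} [CommRing κ] {Y Y' M M' : Type*} [TopologicalSpace Y] [TopologicalSpace Y']
  [TopologicalSpace M] [TopologicalSpace M'] {n k : ℕ}

/-- The operator on chains which replaces a simplex `σ` by the image of the chain `m` under the
map `F σ`. -/
def op (F : C(Spx n, Y) → C(M, Y')) (m : Ch κ k M) : Ch κ n Y →ₗ[κ] Ch κ k Y' :=
  Finsupp.linearCombination κ fun σ => push κ (F σ) m

theorem push_single (φ : C(Y, Y')) (σ : C(Spx n, Y)) (a : κ) :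
    push κ φ (Finsupp.single σ a) = Finsupp.single (φ.comp σ) a :=
  Finsupp.mapDomain_single

theorem push_push {Y'' : Type*} [TopologicalSpace Y''] (ψ : C(Y', Y'')) (φ : C(Y, Y'))
    (z : Ch κ n Y) : push κ ψ (push κ φ z) = push κ (ψ.comp φ) z :=
  (Finsupp.mapDomain_comp (f := fun σ : C(Spx n, Y) => φ.comp σ)
    (g := fun σ : C(Spx n, Y') => ψ.comp σ)).symm

theorem push_id (z : Ch κ n Y) : push κ (ContinuousMap.id Y) z = z :=
  Finsupp.mapDomain_id

theorem bd_single (σ : C(Spx (n + 1), Y)) (a : κ) :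
    bd κ n Y (Finsupp.single σ a) =
      ∑ i : Fin (n + 2), ((-1 : ℤ) ^ (i : ℕ)) • Finsupp.single (σ.comp (face i)) a := by
  simp [bd, LinearMap.sum_apply, Finsupp.mapDomain_single]

theorem op_single (F : C(Spx n, Y) → C(M, Y')) (m : Ch κ k M) (σ : C(Spx n, Y)) (a : κ) :
    op F m (Finsupp.single σ a) = a • push κ (F σ) m :=
  Finsupp.linearCombination_single _ _ _

theorem op_bd (F : C(Spx n, Y) → C(M, Y')) (m : Ch κ (k + 1) M) (z : Ch κ n Y) :
    bd κ k Y' (op F m z) = op F (bd κ k M m) z := by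
  induction z using Finsupp.induction_linear with
  | zero => simp
  | add x y hx hy => rw [map_add, map_add, map_add, hx, hy]
  | single σ a => rw [op_single, op_single, map_smul, push_bd]

theorem op_sub (F : C(Spx n, Y) → C(M, Y')) (m m' : Ch κ k M) (z : Ch κ n Y) :
    op F (m - m') z = op F m z - op F m' z := by
  induction z using Finsupp.induction_linear with
  | zero => simp
  | add x y hx hy => simp only [map_add, hx, hy]; abel
  | single σ a => rw [op_single, op_single, op_single, map_sub, smul_sub]

theorem op_push (F : C(Spx n, Y) → C(M, Y')) (g : C(M', M)) (m : Ch κ k M') (z : Ch κ n Y) :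
    op F (push κ g m) z = op (fun σ => (F σ).comp g) m z := by
  induction z using Finsupp.induction_linear with
  | zero => simp
  | add x y hx hy => rw [map_add, map_add, hx, hy]
  | single σ a => rw [op_single, op_single, push_push]

theorem push_mem_supported {φ : C(Y, Y')} {S : Set C(Spx n, Y)} {T : Set C(Spx n, Y')}
    (h : ∀ σ ∈ S, φ.comp σ ∈ T) {z : Ch κ n Y} (hz : z ∈ Finsupp.supported κ κ S) :
    push κ φ z ∈ Finsupp.supported κ κ T := by
  classical
  intro τ hτ
  obtain ⟨σ, hσ, rfl⟩ := Finset.mem_image.1 (Finsupp.mapDomain_support hτ)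
  exact h σ (hz hσ)

theorem op_mem_supported {F : C(Spx n, Y) → C(M, Y')} {S : Set C(Spx n, Y)} {T : Set C(Spx k, M)}
    {S' : Set C(Spx k, Y')} (h : ∀ σ ∈ S, ∀ τ ∈ T, (F σ).comp τ ∈ S') {m : Ch κ k M}
    (hm : m ∈ Finsupp.supported κ κ T) {z : Ch κ n Y} (hz : z ∈ Finsupp.supported κ κ S) :
    op F m z ∈ Finsupp.supported κ κ S' := by
  rw [op, Finsupp.linearCombination_apply]
  exact Submodule.sum_mem _ fun σ hσ => Submodule.smul_mem _ _
    (push_mem_supported (h σ (hz hσ)) hm)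

/-- The alternating sum of the images of a chain under the maps `d i`. -/
def cosum (d : Fin (n + 2) → C(M, M')) (m : Ch κ k M) : Ch κ k M' :=
  ∑ i : Fin (n + 2), ((-1 : ℤ) ^ (i : ℕ)) • push κ (d i) m

theorem cosum_sub (d : Fin (n + 2) → C(M, M')) (m m' : Ch κ k M) :
    cosum d (m - m') = cosum d m - cosum d m' := by
  simp only [cosum, map_sub, smul_sub, Finset.sum_sub_distrib]

theorem cosum_zero (d : Fin (n + 2) → C(M, M')) : cosum d (0 : Ch κ k M) = 0 := by
  simp [cosum]

theorem bd_cosum (d : Fin (n + 2) → C(M, M')) (m : Ch κ (k + 1) M) :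
    bd κ k M' (cosum d m) = cosum d (bd κ k M m) := by
  simp only [cosum, map_sum, map_zsmul, push_bd]

/-- Compatibility of the maps `F` with faces moves an alternating sum over faces from the model
chain to the boundary of `z`. Asking for it only on `S` allows operators that are natural only for
small simplices. -/
theorem op_cosum {F : C(Spx n, Y) → C(M, Y')} {F' : C(Spx (n + 1), Y) → C(M', Y')}
    {d : Fin (n + 2) → C(M, M')} {S : Set C(Spx (n + 1), Y)}
    (h : ∀ σ ∈ S, ∀ i, (F' σ).comp (d i) = F (σ.comp (face i))) (m : Ch κ k M)
    {z : Ch κ (n + 1) Y} (hz : z ∈ Finsupp.supported κ κ S) :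
    op F' (cosum d m) z = op F m (bd κ n Y z) := by
  rw [← Finsupp.sum_single z, Finsupp.sum, map_sum, map_sum, map_sum]
  refine Finset.sum_congr rfl fun σ hσ => ?_
  rw [op_single, cosum, map_sum, bd_single, map_sum, Finset.smul_sum]
  refine Finset.sum_congr rfl fun i _ => ?_
  rw [map_zsmul, map_zsmul, push_push, h σ (hz hσ), op_single, smul_comm]

theorem mem_supported_univ (z : Ch κ n Y) : z ∈ Finsupp.supported κ κ (Set.univ : Set C(Spx n, Y)) := by
  simp

/-- The simplex `Δⁿ` as a chain in itself. -/
def iota (κ : Type v) [CommRing κ] (n : ℕ) : Ch κ n (Spx n) := Finsupp.single (ContinuousMap.id _) 1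

theorem bd_iota : bd κ n _ (iota κ (n + 1)) = cosum face (iota κ n) := by
  simp only [iota, bd_single, cosum, push_single]
  rfl

theorem op_iota {F : C(Spx n, Y) → C(M, Y')} (g : C(Spx n, M)) {z : Ch κ n Y} :
    op F (push κ g (iota κ n)) z = Finsupp.mapDomain (fun σ => (F σ).comp g) z := by
  rw [op_push, op, iota]
  simp only [push_single, Finsupp.linearCombination_apply, Finsupp.smul_single, smul_eq_mul, mul_one]
  rfl

/-- On the universal simplex `iota`, two applications of `op_cosum` turn the double alternating sum
into a double boundary. -/
theorem cosum_cosum_face (x : Ch κ k (Spx n)) :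
    cosum (face (n := n + 1)) (cosum (face (n := n)) x) = 0 := by
  have h1 := op_cosum (κ := κ) (Y := Spx (n + 2)) (Y' := Spx (n + 2)) (F := fun σ => σ) (F' := fun σ => σ)
    (d := face (n := n + 1)) (S := Set.univ) (fun _ _ _ => rfl) (cosum face x)
    (mem_supported_univ (iota κ (n + 2)))
  have h2 := op_cosum (κ := κ) (Y := Spx (n + 2)) (Y' := Spx (n + 2)) (F := fun σ => σ) (F' := fun σ => σ)
    (d := face (n := n)) (S := Set.univ) (fun _ _ _ => rfl) x
    (mem_supported_univ (bd κ _ _ (iota κ (n + 2))))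
  rw [h2, bd_bd, map_zero, iota, op_single, one_smul, push_id] at h1
  exact h1

/-- The face maps of the cosimplicial space `I × Δⁿ`. -/
def pface (i : Fin (n + 2)) : C(unitInterval × Spx n, unitInterval × Spx (n + 1)) :=
  (ContinuousMap.id unitInterval).prodMap (face i)

theorem cosum_cosum_pface (x : Ch κ k (unitInterval × Spx n)) :
    cosum (pface (n := n + 1)) (cosum (pface (n := n)) x) = 0 := by
  have h1 := op_cosum (κ := κ) (Y := Spx (n + 2)) (Y' := unitInterval × Spx (n + 2))
    (F := fun σ => (ContinuousMap.id unitInterval).prodMap σ) (F' := fun σ => (ContinuousMap.id unitInterval).prodMap σ)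
    (d := pface (n := n + 1)) (S := Set.univ) (fun _ _ _ => rfl) (cosum pface x)
    (mem_supported_univ (iota κ (n + 2)))
  have h2 := op_cosum (κ := κ) (Y := Spx (n + 2)) (Y' := unitInterval × Spx (n + 2))
    (F := fun σ => (ContinuousMap.id unitInterval).prodMap σ) (F' := fun σ => (ContinuousMap.id unitInterval).prodMap σ)
    (d := pface (n := n)) (S := Set.univ) (fun _ _ _ => rfl) x
    (mem_supported_univ (bd κ _ _ (iota κ (n + 2))))
  rw [h2, bd_bd, map_zero, iota, op_single, one_smul] at h1
  exact (push_id _).symm.trans h1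

/-- The augmentation. -/
def aug : Ch κ n Y →ₗ[κ] κ := Finsupp.linearCombination κ fun _ => 1

theorem aug_single (σ : C(Spx n, Y)) (a : κ) : aug (Finsupp.single σ a : Ch κ n Y) = a := by
  simp [aug]

theorem aug_push (φ : C(Y, Y')) (z : Ch κ n Y) : aug (push κ φ z) = aug z := by
  induction z using Finsupp.induction_linear with
  | zero => simp
  | add x y hx hy => rw [map_add, map_add, map_add, hx, hy]
  | single σ a => rw [push_single, aug_single, aug_single]

theorem aug_cosum_of_zero (d : Fin 2 → C(M, M')) (m : Ch κ k M) : aug (cosum (n := 0) d m) = 0 := by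
  simp [cosum, Fin.sum_univ_two, aug_push]

/-- The chain `z` is a cycle of the augmented chain complex. -/
def IsAugCyc (z : Ch κ n Y) : Prop := IsCyc z ∧ (n = 0 → aug z = 0)

theorem IsAugCyc.push {z : Ch κ n Y} (h : IsAugCyc z) (φ : C(Y, Y')) : IsAugCyc (push κ φ z) := by
  refine ⟨?_, fun h0 => (aug_push φ z).trans (h.2 h0)⟩
  cases n with
  | zero => trivial
  | succ n =>
    change bd κ n _ _ = 0
    rw [← push_bd, show bd κ n Y z = 0 from h.1, map_zero]

/-- In degree `0` a chain on a point is determined by its augmentation; in positive degrees the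
homology of a point vanishes. -/
theorem exists_bd_eq_of_punit {z : Ch κ n PUnit.{1}} (hz : IsAugCyc z) : ∃ w, bd κ n _ w = z := by
  obtain ⟨x, hx⟩ := hz.1.exists_rep
  refine hx.eq_zero_iff.1 ?_
  rcases Nat.eq_zero_or_pos n with rfl | hn
  · have hz0 : z = 0 := by
      have key (y : Ch κ 0 PUnit.{1}) :
          y = Finsupp.single (ContinuousMap.const _ PUnit.unit) (aug y) := by
        induction y using Finsupp.induction_linear with
        | zero => simp
        | add y y' h h' => rw [map_add, Finsupp.single_add, ← h, ← h']
        | single σ a =>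
          rw [aug_single]
          congr 1
      rw [key z, hz.2 rfl, Finsupp.single_zero]
    exact hx.eq_zero_iff.2 ⟨0, by rw [map_zero, hz0]⟩
  · have := AlgebraicTopology.isZero_singularHomologyFunctor_of_totallyDisconnectedSpace
      (ModuleCat.{v} κ) n (ModuleCat.of κ (ULift.{0} κ)) (TopCat.of PUnit.{1}) hn.ne'
    have := ModuleCat.subsingleton_of_isZero this
    exact Subsingleton.elim (α := H κ n PUnit.{1}) _ _

/-- Contractible spaces are acyclic. -/
theorem exists_bd_eq_of_contractible {Z : Type} [TopologicalSpace Z] [ContractibleSpace Z]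
    {z : Ch κ n Z} (hz : IsAugCyc z) : ∃ w, bd κ n _ w = z := by
  obtain ⟨b, hb⟩ := id_nullhomotopic Z
  obtain ⟨w, hw⟩ := exists_bd_eq_push_sub_push hb.some hz.1
  obtain ⟨w', hw'⟩ := exists_bd_eq_of_punit (hz.push (ContinuousMap.const Z PUnit.unit))
  refine ⟨w + push κ (ContinuousMap.const PUnit.{1} b) w', ?_⟩
  rw [map_add, hw, ← push_bd, hw', push_push, push_id]
  exact sub_add_cancel _ _

/-- Dependent choice with an invariant `G`: each model chain must be chosen so that the next one can
still be found. -/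
theorem exists_seq_of_step {X : ℕ → Type*} (G : ∀ n, X n → Prop) (R : ∀ n, X n → X (n + 1) → Prop)
    (x₀ : X 0) (h₀ : G 0 x₀) (hs : ∀ n x, G n x → ∃ y, G (n + 1) y ∧ R n x y) :
    ∃ x : ∀ n, X n, x 0 = x₀ ∧ ∀ n, G n (x n) ∧ R n (x n) (x (n + 1)) := by
  choose g hg using hs
  let s : ∀ n, {x : X n // G n x} := fun n =>
    Nat.rec ⟨x₀, h₀⟩ (fun n x => ⟨g n x.1 x.2, (hg n x.1 x.2).1⟩) n
  exact ⟨fun n => (s n).1, rfl, fun n => ⟨(s n).2, (hg n _ _).2⟩⟩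

/-- Acyclic models: a null-homotopy on `unitInterval × Δⁿ`. -/
theorem exists_model_homotopy (A : ∀ n, Ch κ n (unitInterval × Spx n))
    (hA : ∀ n, bd κ n _ (A (n + 1)) = cosum pface (A n)) (hA0 : aug (A 0) = 0) :
    ∃ h : ∀ n, Ch κ (n + 1) (unitInterval × Spx n), bd κ 0 _ (h 0) = A 0 ∧
      ∀ n, bd κ (n + 1) _ (h (n + 1)) = A (n + 1) - cosum pface (h n) := by
  have hc (n : ℕ) : ContractibleSpace (unitInterval × Spx n) := by
    have h1 : ContractibleSpace (Spx n) :=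
      (convex_stdSimplex ℝ (Fin (n + 1))).contractibleSpace ⟨_, (Classical.arbitrary (Spx n)).2⟩
    have h2 : ContractibleSpace unitInterval :=
      (convex_Icc (0 : ℝ) 1).contractibleSpace ⟨0, unitInterval.zero_mem⟩
    infer_instance
  obtain ⟨x₀, hx₀⟩ := exists_bd_eq_of_contractible (z := A 0) ⟨trivial, fun _ => hA0⟩
  -- The invariant says exactly that `A (n + 1) - cosum pface x` is a cycle, which then bounds by
  -- contractibility.
  have hs (n : ℕ) (x : Ch κ (n + 1) (unitInterval × Spx n))
      (hx : cosum (pface (n := n)) (A n - bd κ n _ x) = 0) :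
      ∃ y, cosum (pface (n := n + 1)) (A (n + 1) - bd κ (n + 1) _ y) = 0 ∧
        bd κ (n + 1) _ y = A (n + 1) - cosum pface x := by
    obtain ⟨y, hy⟩ := exists_bd_eq_of_contractible (z := A (n + 1) - cosum pface x)
      ⟨by
        change bd κ n _ _ = 0
        rw [map_sub, bd_cosum, hA, ← cosum_sub, hx], fun h => absurd h (Nat.succ_ne_zero n)⟩
    exact ⟨y, by rw [hy, sub_sub_cancel, cosum_cosum_pface], hy⟩
  obtain ⟨h, rfl, hh⟩ := exists_seq_of_step (X := fun n => Ch κ (n + 1) (unitInterval × Spx n))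
    _ (fun n x y => bd κ (n + 1) _ y = A (n + 1) - cosum pface x) x₀
    (by rw [hx₀, sub_self, cosum_zero]) hs
  exact ⟨h, hx₀, fun n => (hh n).2⟩

/-- The chain homotopy obtained from a natural family of maps from `unitInterval × Δⁿ`. -/
theorem exists_bd_eq_op (A : ∀ n, Ch κ n (unitInterval × Spx n))
    (hA : ∀ n, bd κ n _ (A (n + 1)) = cosum pface (A n)) (hA0 : aug (A 0) = 0)
    (S : ∀ n, Set C(Spx n, Y)) (F : ∀ n, C(Spx n, Y) → C(unitInterval × Spx n, Y'))
    (hF : ∀ n, ∀ σ ∈ S (n + 1), ∀ i, (F (n + 1) σ).comp (pface i) = F n (σ.comp (face i)))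
    {z : Ch κ n Y} (hz : IsCyc z) (hzS : z ∈ Finsupp.supported κ κ (S n)) :
    ∃ w, bd κ n Y' w = op (F n) (A n) z ∧ ∀ (S₀ : Set C(Spx n, Y)) (S' : Set C(Spx (n + 1), Y')),
      z ∈ Finsupp.supported κ κ S₀ → (∀ σ ∈ S₀ ∩ S n, ∀ τ, (F n σ).comp τ ∈ S') →
        w ∈ Finsupp.supported κ κ S' := by
  obtain ⟨h, h0, hs⟩ := exists_model_homotopy A hA hA0
  refine ⟨op (F n) (h n) z, ?_, fun S₀ S' h₀ h' =>
    op_mem_supported (S := S₀ ∩ S n) (T := Set.univ) (fun σ hσ τ _ => h' σ hσ τ)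
      (mem_supported_univ _) (fun x hx => ⟨h₀ hx, hzS hx⟩)⟩
  rw [op_bd]
  cases n with
  | zero => rw [h0]
  | succ n =>
    rw [hs, op_sub, op_cosum (hF n) _ hzS, show bd κ n Y z = 0 from hz, map_zero, sub_zero]

/-- The inclusion `Δⁿ → unitInterval × Δⁿ` at height `s`. -/
def inclAt (n : ℕ) (s : unitInterval) : C(Spx n, unitInterval × Spx n) :=
  (ContinuousMap.const _ s).prodMk (ContinuousMap.id _)

theorem bd_push_inclAt (c : ∀ n, Ch κ n (Spx n)) (hc : ∀ n, bd κ n _ (c (n + 1)) = cosum face (c n))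
    (s : unitInterval) (n : ℕ) : bd κ n _ (push κ (inclAt (n + 1) s) (c (n + 1))) =
      cosum pface (push κ (inclAt n s) (c n)) := by
  rw [← push_bd, hc, cosum, map_sum, cosum]
  refine Finset.sum_congr rfl fun i _ => ?_
  rw [map_zsmul, push_push, push_push]
  rfl

/-- The prism operator. -/
theorem exists_bd_eq_of_homotopy (S : ∀ n, Set C(Spx n, Y)) (F : ∀ n, C(Spx n, Y) → C(unitInterval × Spx n, Y'))
    (hF : ∀ n, ∀ σ ∈ S (n + 1), ∀ i, (F (n + 1) σ).comp (pface i) = F n (σ.comp (face i)))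
    {z : Ch κ n Y} (hz : IsCyc z) (hzS : z ∈ Finsupp.supported κ κ (S n)) :
    ∃ w, bd κ n Y' w = Finsupp.mapDomain (fun σ => (F n σ).comp (inclAt n 1)) z -
        Finsupp.mapDomain (fun σ => (F n σ).comp (inclAt n 0)) z ∧
      ∀ (S₀ : Set C(Spx n, Y)) (S' : Set C(Spx (n + 1), Y')),
      z ∈ Finsupp.supported κ κ S₀ → (∀ σ ∈ S₀ ∩ S n, ∀ τ, (F n σ).comp τ ∈ S') →
        w ∈ Finsupp.supported κ κ S' := by
  -- The model chains are top minus bottom of the prism; their augmentation is zero.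
  obtain ⟨w, hw, h⟩ := exists_bd_eq_op
    (fun n => push κ (inclAt n 1) (iota κ n) - push κ (inclAt n 0) (iota κ n))
    (fun n => by rw [map_sub, bd_push_inclAt _ (fun n => bd_iota),
      bd_push_inclAt _ (fun n => bd_iota), cosum_sub]) (by rw [map_sub, aug_push, aug_push, sub_self])
    S F hF hz hzS
  exact ⟨w, by rw [hw, op_sub, op_iota, op_iota], h⟩

end Operators

/-! ### Fine natural subdivisions -/

section Subdivision

variable {κ : Type v} [CommRing κ] {n k : ℕ}

/-- The simplices of diameter less than `ε`. -/
def smallSpx (k : ℕ) (K : Type*) [PseudoMetricSpace K] (ε : ℝ) : Set C(Spx k, K) :=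
  {τ | ∃ d < ε, ∀ x y, dist (τ x) (τ y) ≤ d}

theorem face_apply_succAbove (i : Fin (n + 2)) (x : Spx n) (j : Fin (n + 1)) :
    (face i x).1 (i.succAbove j) = x.1 j := by
  classical
  change (stdSimplex.map i.succAbove x) (i.succAbove j) = _
  rw [stdSimplex.map_coe, FunOnFinite.linearMap_apply_apply]
  have : Finset.univ.filter (fun a => i.succAbove a = i.succAbove j) = {j} := by
    ext a; simp
  rw [this, Finset.sum_singleton]
  rfl

theorem face_apply_self (i : Fin (n + 2)) (x : Spx n) : (face i x).1 i = 0 := by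
  classical
  change (stdSimplex.map i.succAbove x) i = _
  rw [stdSimplex.map_coe, FunOnFinite.linearMap_apply_apply]
  refine Finset.sum_eq_zero fun a ha => ?_
  simp [Fin.succAbove_ne] at ha

theorem sum_face {E : Type*} [AddCommGroup E] [Module ℝ E] (i : Fin (n + 2)) (x : Spx n)
    (q : Fin (n + 2) → E) :
    ∑ j, (face i x).1 j • q j = ∑ j, x.1 j • q (i.succAbove j) := by
  rw [Fin.sum_univ_succAbove _ i, face_apply_self, zero_smul, zero_add]
  simp only [face_apply_succAbove]

theorem dist_face_le (i : Fin (n + 2)) (x y : Spx n) : dist (face i x) (face i y) ≤ dist x y := by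
  rw [Subtype.dist_eq, dist_pi_le_iff dist_nonneg]
  intro j
  rcases Fin.eq_self_or_eq_succAbove i j with rfl | ⟨j, rfl⟩
  · rw [face_apply_self, face_apply_self, dist_self]
    exact dist_nonneg
  · rw [face_apply_succAbove, face_apply_succAbove]
    exact dist_le_pi_dist x.1 y.1 j

theorem face_vertex (i : Fin (n + 2)) (j : Fin (n + 1)) :
    face i (stdSimplex.vertex j) = stdSimplex.vertex (S := ℝ) (i.succAbove j) :=
  stdSimplex.map_vertex _ _

/-- The straight contraction of the standard simplex to a point. -/
def contract (b : Spx n) : C(unitInterval × Spx n, Spx n) where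
  toFun p := ⟨(1 - p.1 : ℝ) • p.2.1 + (p.1 : ℝ) • b.1,
    convex_stdSimplex ℝ _ p.2.2 b.2 (by linarith [p.1.2.2]) p.1.2.1 (by ring)⟩
  continuous_toFun := by fun_prop

/-- Coordinates of two points of the simplex differ by at most `1`, so a change of parameter costs
no more than its own size. -/
theorem dist_contract_le (b : Spx n) (s s' : unitInterval) (x y : Spx n) :
    dist (contract b (s, x)) (contract b (s', y)) ≤ dist x y + |(s : ℝ) - s'| := by
  rw [Subtype.dist_eq, dist_pi_le_iff (by positivity)]
  intro j
  have h1 : |x.1 j - y.1 j| ≤ dist x y := dist_le_pi_dist x.1 y.1 j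
  have h2 : |b.1 j - y.1 j| ≤ 1 := by
    rw [abs_le]
    have := mem_Icc_of_mem_stdSimplex b.2 j
    have := mem_Icc_of_mem_stdSimplex y.2 j
    simp only [Set.mem_Icc] at *
    constructor <;> linarith
  have h3 : |1 - (s : ℝ)| ≤ 1 := by
    rw [abs_le]; constructor <;> linarith [s.2.1, s.2.2]
  change |((1 - s : ℝ) * x.1 j + (s : ℝ) * b.1 j) - ((1 - s' : ℝ) * y.1 j + (s' : ℝ) * b.1 j)| ≤ _
  calc _ = |(1 - s : ℝ) * (x.1 j - y.1 j) + ((s : ℝ) - s') * (b.1 j - y.1 j)| := by ring_nf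
    _ ≤ |(1 - s : ℝ)| * |x.1 j - y.1 j| + |(s : ℝ) - s'| * |b.1 j - y.1 j| := by
      rw [← abs_mul, ← abs_mul]; exact abs_add_le _ _
    _ ≤ 1 * dist x y + |(s : ℝ) - s'| * 1 := by gcongr
    _ = _ := by ring

theorem contract_zero (b x : Spx n) : contract b (0, x) = x := by
  apply Subtype.ext
  simp [contract]

theorem contract_one (b x : Spx n) : contract b (1, x) = b := by
  apply Subtype.ext
  simp [contract]

/-- The parameter `s ↦ (j + s) / M`, clamped to the unit interval. -/
def stepParam (M j : ℕ) : C(unitInterval, unitInterval) where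
  toFun s := Set.projIcc 0 1 zero_le_one ((j + s : ℝ) / M)
  continuous_toFun := continuous_projIcc.comp (by fun_prop)

theorem abs_stepParam_sub_le (M j : ℕ) (s s' : unitInterval) :
    |(stepParam M j s : ℝ) - stepParam M j s'| ≤ 1 / M := by
  have h : |(stepParam M j s : ℝ) - stepParam M j s'| ≤ |(j + s : ℝ) / M - (j + s' : ℝ) / M| :=
    Set.abs_projIcc_sub_projIcc zero_le_one
  refine h.trans ?_
  rw [← sub_div, abs_div, Nat.abs_cast]
  gcongr
  rw [abs_le]
  constructor <;> linarith [s.2.1, s.2.2, s'.2.1, s'.2.2]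

/-- Chains of small simplices of a simplex are acyclic. -/
theorem exists_small_bd_eq {ε : ℝ} (hε : 0 < ε) {z : Ch κ k (Spx n)} (hz : IsAugCyc z)
    (hs : z ∈ Finsupp.supported κ κ (smallSpx k (Spx n) ε)) :
    ∃ w ∈ Finsupp.supported κ κ (smallSpx (k + 1) (Spx n) ε), bd κ k _ w = z := by
  let b : Spx n := Classical.arbitrary _
  -- The contraction is cut into `M` slices. Each of the finitely many simplices has diameter
  -- bounded by some `d < ε`, and `1 / M` must fit into the slack, so that the prisms over a slice
  -- stay small.
  obtain ⟨M, hM, hM0⟩ : ∃ M : ℕ, (∀ σ ∈ z.support, ∃ d, d + 1 / (M : ℝ) < ε ∧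
      ∀ x y, dist (σ x) (σ y) ≤ d) ∧ 0 < M := by
    have : ∀ᶠ M : ℕ in Filter.atTop, ∀ σ ∈ z.support, ∃ d, d + 1 / (M : ℝ) < ε ∧
        ∀ x y, dist (σ x) (σ y) ≤ d := by
      rw [Filter.eventually_all_finset]
      intro σ hσ
      obtain ⟨d, hd, h⟩ := hs hσ
      have := (tendsto_one_div_atTop_nhds_zero_nat (𝕜 := ℝ)).const_add d
      rw [add_zero] at this
      filter_upwards [this.eventually_lt_const hd] with M hM
      exact ⟨d, hM, h⟩
    exact (this.and (Filter.eventually_gt_atTop 0)).exists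
  let F (j : ℕ) (m : ℕ) (σ : C(Spx m, Spx n)) : C(unitInterval × Spx m, Spx n) :=
    (contract b).comp ((stepParam M j).prodMap σ)
  let g (j : ℕ) : C(Spx n, Spx n) := ((contract b).comp ((stepParam M j).prodMap (.id _))).comp (inclAt n 0)
  have hF1 (j : ℕ) (σ : C(Spx k, Spx n)) : (F j k σ).comp (inclAt k 1) = (g (j + 1)).comp σ := by
    ext1 x
    have : stepParam M j 1 = stepParam M (j + 1) 0 := by simp [stepParam]
    exact congrArg (fun s => contract b (s, σ x)) this
  have key (j : ℕ) : ∃ w ∈ Finsupp.supported κ κ (smallSpx (k + 1) (Spx n) ε),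
      bd κ k _ w = push κ (g (j + 1)) z - push κ (g j) z := by
    obtain ⟨w, hw, hws⟩ := exists_bd_eq_of_homotopy (fun _ => Set.univ) (F j)
      (fun _ _ _ _ => rfl) hz.1 (mem_supported_univ z)
    refine ⟨w, hws (z.support : Set _) _ (fun _ h => h) fun σ hσ τ => ?_, ?_⟩
    · obtain ⟨d, hd, h⟩ := hM σ hσ.1
      exact ⟨_, hd, fun x y => (dist_contract_le b _ _ _ _).trans
        (add_le_add (h _ _) (abs_stepParam_sub_le _ _ _ _))⟩
    · rw [hw]
      simp only [hF1]
      rfl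
  choose w hws hw using key
  obtain ⟨w', hw'⟩ := exists_bd_eq_of_punit (hz.push (ContinuousMap.const _ PUnit.unit))
  have hb : push κ (ContinuousMap.const PUnit.{1} b) w' ∈
      Finsupp.supported κ κ (smallSpx (k + 1) (Spx n) ε) :=
    push_mem_supported (φ := ContinuousMap.const PUnit.{1} b) (S := Set.univ) (T := smallSpx (k + 1) (Spx n) ε)
      (fun σ _ => ⟨0, hε, fun x y => (dist_self b).le⟩)
      (mem_supported_univ _)
  -- The slices telescope to `const_b z - z`. The term `const_b z` bounds a chain of constant
  -- simplices, which are small.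
  refine ⟨push κ (ContinuousMap.const PUnit.{1} b) w' - ∑ j ∈ Finset.range M, w j,
    Submodule.sub_mem _ hb (Submodule.sum_mem _ fun j _ => hws j), ?_⟩
  · have h0 : g 0 = ContinuousMap.id _ := by
      ext1 x
      refine Eq.trans ?_ (contract_zero b x)
      have : stepParam M 0 0 = 0 := by simp [stepParam]
      exact congrArg (fun s => contract b (s, x)) this
    have h1 : g M = ContinuousMap.const _ b := by
      ext1 x
      refine Eq.trans ?_ (contract_one b x)
      have : stepParam M M 0 = 1 := by simp [stepParam, hM0.ne']
      exact congrArg (fun s => contract b (s, x)) this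
    rw [map_sub, ← push_bd, hw', push_push, map_sum]
    simp only [hw]
    rw [Finset.sum_range_sub (fun j => push κ (g j) z), h0, h1, push_id]
    exact sub_sub_cancel _ _

/-- Arbitrarily fine natural subdivisions of the standard simplices. -/
theorem exists_subdivision (κ : Type v) [CommRing κ] {ε : ℝ} (hε : 0 < ε) :
    ∃ c : ∀ n, Ch κ n (Spx n), c 0 = iota κ 0 ∧
      (∀ n, bd κ n _ (c (n + 1)) = cosum face (c n)) ∧
      ∀ n, c n ∈ Finsupp.supported κ κ (smallSpx n (Spx n) ε) := by
  -- The next subdivision fills the subdivided boundary, so the invariant is that `cosum face x` is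
  -- a cycle.
  have hs (n : ℕ) (x : Ch κ n (Spx n)) (hx : x ∈ Finsupp.supported κ κ (smallSpx n (Spx n) ε) ∧
      IsCyc (cosum (face (n := n)) x)) : ∃ y : Ch κ (n + 1) (Spx (n + 1)),
      (y ∈ Finsupp.supported κ κ (smallSpx (n + 1) (Spx (n + 1)) ε) ∧
        IsCyc (cosum (face (n := n + 1)) y)) ∧ bd κ n _ y = cosum face x := by
    obtain ⟨y, hy, hxy⟩ := exists_small_bd_eq (z := cosum (face (n := n)) x) hε
      ⟨hx.2, by rintro rfl; exact aug_cosum_of_zero _ _⟩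
      (Submodule.sum_mem _ fun i _ => zsmul_mem (push_mem_supported (fun σ hσ => by
        obtain ⟨d, hd, h⟩ := hσ
        exact ⟨d, hd, fun x y => (dist_face_le i _ _).trans (h x y)⟩) hx.1) _)
    refine ⟨y, ⟨hy, ?_⟩, hxy⟩
    change bd κ n _ _ = 0
    rw [bd_cosum, hxy, cosum_cosum_face]
  obtain ⟨c, h0, hc⟩ := exists_seq_of_step (X := fun n => Ch κ n (Spx n)) _ _ (iota κ 0)
    ⟨by
      refine Finsupp.single_mem_supported κ 1 ⟨0, hε, fun x y => ?_⟩
      rw [Subsingleton.elim x y, dist_self], trivial⟩ hs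
  exact ⟨c, h0, fun n => (hc n).2, fun n => (hc n).1.1⟩

variable {Y : Type*} [TopologicalSpace Y]

/-- The simplices with image in `A`. -/
def within (k : ℕ) (A : Set Y) : Set C(Spx k, Y) := {σ | ∀ x, σ x ∈ A}

/-- A cycle and a chain which it bounds may be replaced by small ones. -/
theorem exists_small_chains (G : ∀ k, Set C(Spx k, Y))
    (hG : ∀ {m : ℕ} (σ : C(Spx m, Y)), ∃ ε > 0, ∀ {k : ℕ}, ∀ τ ∈ smallSpx k (Spx m) ε,
      σ.comp τ ∈ G k) (w : Ch κ (n + 1) Y) :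
    ∃ (w' : Ch κ (n + 1) Y) (h : Ch κ (n + 1) Y),
      w' ∈ Finsupp.supported κ κ (G (n + 1)) ∧ bd κ n _ w' ∈ Finsupp.supported κ κ (G n) ∧
      bd κ n _ h = bd κ n _ w - bd κ n _ w' ∧
      ∀ A : Set Y, bd κ n _ w ∈ Finsupp.supported κ κ (within n A) →
        bd κ n _ w' ∈ Finsupp.supported κ κ (within n A) ∧
        h ∈ Finsupp.supported κ κ (within (n + 1) A) := by
  choose! e he hG using @hG
  -- One mesh serves the finitely many simplices of `w` and of its boundary; the latter are
  -- subdivided independently and need their own bound.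
  obtain ⟨ε, hε, hεe, hεe'⟩ : ∃ ε > 0, (∀ σ ∈ w.support, ε ≤ e σ) ∧
      ∀ σ ∈ (bd κ n _ w).support, ε ≤ e σ := by
    have h1 : ∀ᶠ ε in nhdsWithin (0 : ℝ) (Set.Ioi 0), ∀ σ ∈ w.support, ε ≤ e σ := by
      rw [Filter.eventually_all_finset]
      exact fun σ _ => nhdsWithin_le_nhds (Iic_mem_nhds (he σ))
    have h2 : ∀ᶠ ε in nhdsWithin (0 : ℝ) (Set.Ioi 0), ∀ σ ∈ (bd κ n _ w).support, ε ≤ e σ := by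
      rw [Filter.eventually_all_finset]
      exact fun σ _ => nhdsWithin_le_nhds (Iic_mem_nhds (he σ))
    obtain ⟨ε, ⟨h1, h2⟩, h3⟩ := ((h1.and h2).and self_mem_nhdsWithin).exists
    exact ⟨ε, h3, h1, h2⟩
  have hsm {m k : ℕ} {σ : C(Spx m, Y)} (h : ε ≤ e σ) {τ : C(Spx k, Spx m)}
      (hτ : τ ∈ smallSpx k (Spx m) ε) : σ.comp τ ∈ G k :=
    hG σ τ (by obtain ⟨d, hd, h'⟩ := hτ; exact ⟨d, hd.trans_le h, h'⟩)
  obtain ⟨c, hc0, hc, hcs⟩ := exists_subdivision κ hε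
  have hT : bd κ n _ (op (fun σ => σ) (c (n + 1)) w) = op (fun σ => σ) (c n) (bd κ n Y w) := by
    rw [op_bd, hc]
    exact op_cosum (fun _ _ _ => rfl) _ (mem_supported_univ w)
  -- Identity minus subdivision, both placed at height `0`. The maps `σ ∘ snd` forget the interval,
  -- so the homotopy never leaves the image of `σ`.
  obtain ⟨h, hh, hhs⟩ := exists_bd_eq_op
    (fun n => push κ (inclAt n 0) (iota κ n) - push κ (inclAt n 0) (c n))
    (fun n => by rw [map_sub, bd_push_inclAt _ (fun n => bd_iota), bd_push_inclAt _ hc, cosum_sub])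
    (by rw [hc0, sub_self, map_zero])
    (fun _ => Set.univ) (fun n σ => σ.comp ContinuousMap.snd) (fun _ _ _ _ => rfl)
    (isCyc_bd w) (mem_supported_univ _)
  refine ⟨op (fun σ => σ) (c (n + 1)) w, h,
    op_mem_supported (S := w.support) (fun σ hσ τ hτ => hsm (hεe σ hσ) hτ) (hcs _) fun _ h => h,
    ?_, ?_, fun A hA => ⟨?_, hhs _ _ hA fun σ hσ τ x => hσ.1 _⟩⟩
  · rw [hT]
    exact op_mem_supported (S := (bd κ n _ w).support) (fun σ hσ τ hτ => hsm (hεe' σ hσ) hτ)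
      (hcs _) fun _ h => h
  · rw [hh, op_sub, op_iota, op_push, hT]
    congr 1
    exact Finsupp.mapDomain_id
  · rw [hT]
    exact op_mem_supported (F := fun σ => σ) (S := within n A) (T := Set.univ) (S' := within n A)
      (fun σ hσ τ _ x => hσ _) (mem_supported_univ _) hA

end Subdivision

/-! ### The degree filtration of the group ring -/

section Filtration

variable {κ : Type v} [Field κ] {Γ : AddSubgroup ℝ}

/-- The elements of the group ring `κ[Γ]`, `Γ ⊆ ℝ`, of degree at most `a`. -/
def degLE (κ : Type v) [Field κ] (Γ : AddSubgroup ℝ) (a : ℝ) : AddSubgroup (AddMonoidAlgebra κ Γ) where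
  carrier := {p | ∀ γ ∈ p.coeff.support, (γ : ℝ) ≤ a}
  zero_mem' := by simp
  add_mem' := by
    classical
    intro p q hp hq γ hγ
    rcases Finset.mem_union.1 (Finsupp.support_add hγ) with h | h
    exacts [hp γ h, hq γ h]
  neg_mem' := by
    intro p hp γ hγ
    exact hp γ (by simpa using hγ)

theorem degLE_mono {a b : ℝ} (h : a ≤ b) : degLE κ Γ a ≤ degLE κ Γ b :=
  fun _ hp γ hγ => (hp γ hγ).trans h

theorem mul_mem_degLE {a b : ℝ} {p q : AddMonoidAlgebra κ Γ} (hp : p ∈ degLE κ Γ a)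
    (hq : q ∈ degLE κ Γ b) : p * q ∈ degLE κ Γ (a + b) := by
  classical
  intro γ hγ
  obtain ⟨x, hx, y, hy, rfl⟩ := Finset.mem_add.1 (AddMonoidAlgebra.support_coeff_mul_subset p q hγ)
  exact add_le_add (hp x hx) (hq y hy)

theorem eventually_mem_degLE (p : AddMonoidAlgebra κ Γ) : ∀ᶠ a in Filter.atTop, p ∈ degLE κ Γ a := by
  change ∀ᶠ a in Filter.atTop, ∀ γ ∈ p.coeff.support, (γ : ℝ) ≤ a
  rw [Filter.eventually_all_finset]
  exact fun γ _ => Filter.eventually_ge_atTop _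

theorem exists_forall_mem_degLE {J : Type*} [Finite J] (l : J → AddMonoidAlgebra κ Γ) :
    ∃ c, 0 ≤ c ∧ ∀ j, l j ∈ degLE κ Γ c :=
  ((Filter.eventually_ge_atTop 0).and
    (Filter.eventually_all.2 fun j => eventually_mem_degLE (l j))).exists

/-- A non-zero element of `κ[Γ]` is a unit times `1 - q` with `q` of negative degree. -/
theorem exists_eq_unit_mul {p : AddMonoidAlgebra κ Γ} (hp : p ≠ 0) :
    ∃ (w w' q : AddMonoidAlgebra κ Γ) (δ : ℝ), w * w' = 1 ∧ p = w * (1 - q) ∧ 0 < δ ∧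
      q ∈ degLE κ Γ (-δ) := by
  have hne : p.coeff.support.Nonempty := by
    rw [Finsupp.support_nonempty_iff]
    simpa using hp
  obtain ⟨γ₀, h₀, hmax⟩ := p.coeff.support.exists_max_image id hne
  set c := p.coeff γ₀
  have hc : c ≠ 0 := Finsupp.mem_support_iff.1 h₀
  -- `w` is the leading term of `p` and `w'` its inverse. Dividing by it leaves `1` plus terms of
  -- negative degree, and the finite support keeps these degrees away from `0`.
  let w : AddMonoidAlgebra κ Γ := .single γ₀ c
  let w' : AddMonoidAlgebra κ Γ := .single (-γ₀) c⁻¹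
  have hw : w * w' = 1 := by
    rw [AddMonoidAlgebra.single_mul_single, add_neg_cancel, mul_inv_cancel₀ hc]
    rfl
  let q := 1 - w' * p
  have hq (γ : Γ) (hγ : γ ∈ q.coeff.support) : (γ : ℝ) < 0 := by
    have h1 : q.coeff γ ≠ 0 := Finsupp.mem_support_iff.1 hγ
    have h2 : q.coeff γ = (1 : AddMonoidAlgebra κ Γ).coeff γ - c⁻¹ * p.coeff (γ₀ + γ) := by
      change (1 - w' * p).coeff γ = _
      rw [AddMonoidAlgebra.coeff_sub, Finsupp.sub_apply, AddMonoidAlgebra.coeff_single_mul_apply,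
        neg_neg]
    rw [h2] at h1
    by_cases hγ0 : γ = 0
    · rw [hγ0, add_zero, AddMonoidAlgebra.coeff_one_zero, inv_mul_cancel₀ hc, sub_self] at h1
      exact absurd rfl h1
    · have h3 : (1 : AddMonoidAlgebra κ Γ).coeff γ = 0 := by
        rw [AddMonoidAlgebra.one_def, AddMonoidAlgebra.coeff_single,
          Finsupp.single_eq_of_ne hγ0]
      rw [h3, zero_sub, neg_ne_zero] at h1
      have h4 := hmax (γ₀ + γ) (Finsupp.mem_support_iff.2 (right_ne_zero_of_mul h1))
      have h5 : (γ : ℝ) ≤ 0 := by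
        have : ((γ₀ + γ : Γ) : ℝ) ≤ γ₀ := h4
        simpa using this
      exact lt_of_le_of_ne h5 fun h => hγ0 (Subtype.ext h)
  obtain ⟨δ, hδ, hδ0⟩ : ∃ δ : ℝ, (∀ γ ∈ q.coeff.support, (γ : ℝ) ≤ -δ) ∧ 0 < δ := by
    have h1 : ∀ᶠ δ in nhdsWithin (0 : ℝ) (Set.Ioi 0), ∀ γ ∈ q.coeff.support, (γ : ℝ) ≤ -δ := by
      rw [Filter.eventually_all_finset]
      intro γ hγ
      filter_upwards [nhdsWithin_le_nhds (Iic_mem_nhds (neg_pos.2 (hq γ hγ)))] with δ hδ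
      linarith [show δ ≤ -(γ : ℝ) from hδ]
    exact (h1.and self_mem_nhdsWithin).exists
  refine ⟨w, w', q, δ, hw, ?_, hδ0, hδ⟩
  rw [show 1 - q = w' * p from sub_sub_cancel _ _, ← mul_assoc, hw, one_mul]

/-- Division with remainder of arbitrarily low degree. -/
theorem exists_div_degLE {p : AddMonoidAlgebra κ Γ} (hp : p ≠ 0) (x : AddMonoidAlgebra κ Γ)
    (b : ℝ) : ∃ z, x - z * p ∈ degLE κ Γ b := by
  obtain ⟨w, w', q, δ, hw, rfl, hδ, hq⟩ := exists_eq_unit_mul hp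
  obtain ⟨a, ha⟩ := (eventually_mem_degLE x).exists
  -- Adding `w'` times the remainder to the quotient multiplies the remainder by `q`, which lowers
  -- its degree by `δ`.
  have key (n : ℕ) : ∃ z, x - z * (w * (1 - q)) ∈ degLE κ Γ (a - n * δ) := by
    induction n with
    | zero => exact ⟨0, by simpa using ha⟩
    | succ n ih =>
      obtain ⟨z, hz⟩ := ih
      refine ⟨z + w' * (x - z * (w * (1 - q))), ?_⟩
      have h := mul_mem_degLE hz hq
      have e : x - (z + w' * (x - z * (w * (1 - q)))) * (w * (1 - q)) =
          (x - z * (w * (1 - q))) * q := by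
        linear_combination (-(x - z * (w * (1 - q))) * (1 - q)) * hw
      rw [e]
      refine degLE_mono ?_ h
      push_cast
      linarith
  obtain ⟨n, hn⟩ := exists_nat_ge ((a - b) / δ)
  obtain ⟨z, hz⟩ := key n
  exact ⟨z, degLE_mono (by rw [div_le_iff₀ hδ] at hn; linarith) hz⟩

/-- Multiplication by a non-zero element lowers degrees at most by a constant. -/
theorem exists_cancel_degLE {p : AddMonoidAlgebra κ Γ} (hp : p ≠ 0) :
    ∃ c, ∀ x a, p * x ∈ degLE κ Γ a → x ∈ degLE κ Γ (a + c) := by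
  obtain ⟨w, w', q, δ, hw, rfl, hδ, hq⟩ := exists_eq_unit_mul hp
  obtain ⟨c, hc⟩ := (eventually_mem_degLE w').exists
  refine ⟨c, fun x a hx => ?_⟩
  have h1 : x - q * x ∈ degLE κ Γ (a + c) := by
    have := mul_mem_degLE hx hc
    rwa [show w * (1 - q) * x * w' = x - q * x by linear_combination (1 - q) * x * hw] at this
  obtain ⟨b, hb⟩ := (eventually_mem_degLE x).exists
  -- In `x = (x - q * x) + q * x` the first summand has degree at most `a + c`, so any worse bound
  -- for `x` improves by `δ` until it reaches `a + c`.
  have key (n : ℕ) : x ∈ degLE κ Γ (max (a + c) (b - n * δ)) := by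
    induction n with
    | zero => exact degLE_mono (by simp) hb
    | succ n ih =>
      have h2 := mul_mem_degLE hq ih
      rw [show x = (x - q * x) + q * x by ring]
      refine add_mem (degLE_mono (le_max_left _ _) h1) (degLE_mono ?_ h2)
      rcases le_total (a + c) (b - n * δ) with h | h
      · rw [max_eq_right h]
        refine le_max_of_le_right ?_
        push_cast
        linarith
      · rw [max_eq_left h]
        exact le_max_of_le_left (by linarith)
  obtain ⟨n, hn⟩ := exists_nat_ge ((b - (a + c)) / δ)
  have := key n
  rwa [max_eq_left (by rw [div_le_iff₀ hδ] at hn; linarith)] at this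

end Filtration

/-- Over a domain, a vector is either torsion modulo the span of a finite family, or separated from
the family by a linear functional. -/
theorem exists_torsion_or_functional {Λ : Type*} [CommRing Λ] [IsDomain Λ] {ι J : Type*}
    [Fintype ι] [Fintype J] (m : ι → J → Λ) (x : J → Λ) :
    (∃ (d : Λ) (q : ι → Λ), d ≠ 0 ∧ ∀ j, d * x j = ∑ i, q i * m i j) ∨
    ∃ l : J → Λ, (∀ i, ∑ j, m i j * l j = 0) ∧ ∑ j, x j * l j ≠ 0 := by
  classical
  -- The dichotomy is that of a vector space over `K`: the vector lies in the span or a functional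
  -- separates it. Both outcomes descend to `Λ` by clearing finitely many denominators.
  let K := FractionRing Λ
  let φ : (J → Λ) → (J → K) := fun y j => algebraMap Λ K (y j)
  have hinj : Function.Injective (algebraMap Λ K) := IsFractionRing.injective Λ K
  by_cases hx : φ x ∈ Submodule.span K (Set.range fun i => φ (m i))
  · left
    obtain ⟨k, hk⟩ := (Submodule.mem_span_range_iff_exists_fun K).1 hx
    obtain ⟨d, hd⟩ := IsLocalization.exist_integer_multiples_of_finite (nonZeroDivisors Λ) k
    choose q hq using hd
    refine ⟨d, q, nonZeroDivisors.ne_zero d.2, fun j => hinj ?_⟩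
    have := congrFun hk j
    rw [map_mul, map_sum]
    change _ * φ x j = _
    rw [← this, Finset.sum_apply, Finset.mul_sum]
    refine Finset.sum_congr rfl fun i _ => ?_
    rw [map_mul, hq, Algebra.smul_def (d : Λ) (k i)]
    exact (mul_assoc (algebraMap Λ K d) (k i) (φ (m i) j)).symm
  · right
    obtain ⟨f, hf, hle⟩ := Submodule.exists_le_ker_of_notMem hx
    obtain ⟨d, hd⟩ := IsLocalization.exist_integer_multiples_of_finite (nonZeroDivisors Λ)
      (fun j => f (Pi.single j 1))
    choose l hl using hd
    have key (y : J → Λ) : algebraMap Λ K (∑ j, y j * l j) = algebraMap Λ K d * f (φ y) := by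
      rw [map_sum, f.pi_apply_eq_sum_univ, Finset.mul_sum]
      refine Finset.sum_congr rfl fun j _ => ?_
      rw [map_mul, hl, Algebra.smul_def, smul_eq_mul]
      have : (fun j' => if j = j' then (1 : K) else 0) = Pi.single j 1 := by
        ext j'
        simp [Pi.single_apply, eq_comm]
      rw [this]
      ring
    refine ⟨l, fun i => hinj ?_, fun h => ?_⟩
    · rw [key, map_zero, show f (φ (m i)) = 0 from hle (Submodule.subset_span ⟨i, rfl⟩), mul_zero]
    · have h1 := key x
      rw [h, map_zero, eq_comm, mul_eq_zero] at h1
      rcases h1 with h1 | h1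
      · exact nonZeroDivisors.ne_zero d.2 (hinj (h1.trans (map_zero _).symm))
      · exact hf h1

/-! ### Strictness of matrices over the group ring -/

section Filtration

variable {κ : Type v} [Field κ] {Γ : AddSubgroup ℝ}

theorem sum_mul_mem_degLE {J : Type*} [Fintype J] {x l : J → AddMonoidAlgebra κ Γ} {a c : ℝ}
    (hx : ∀ j, x j ∈ degLE κ Γ a) (hl : ∀ j, l j ∈ degLE κ Γ c) :
    ∑ j, x j * l j ∈ degLE κ Γ (a + c) :=
  sum_mem fun j _ => mul_mem_degLE (hx j) (hl j)

/-- Linear maps between finite free `κ[Γ]`-modules are strict up to a constant for the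
filtrations by degree. -/
theorem exists_strict {J : Type*} [Fintype J] (n : ℕ) (m : Fin n → J → AddMonoidAlgebra κ Γ) :
    ∃ N, 0 ≤ N ∧ ∀ (a : ℝ) (y : Fin n → AddMonoidAlgebra κ Γ),
      (∀ j, ∑ i, y i * m i j ∈ degLE κ Γ a) →
      ∃ y' : Fin n → AddMonoidAlgebra κ Γ, (∀ j, ∑ i, y' i * m i j = ∑ i, y i * m i j) ∧
        ∀ i, y' i ∈ degLE κ Γ (a + N) := by
  induction n with
  | zero => exact ⟨0, le_rfl, fun a y _ => ⟨y, fun _ => rfl, fun i => i.elim0⟩⟩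
  | succ n ih =>
    obtain ⟨N, hN, ih⟩ := ih fun i => m i.castSucc
    obtain ⟨c, hc, hm⟩ := exists_forall_mem_degLE (m (Fin.last n))
    rcases exists_torsion_or_functional (fun i : Fin n => m i.castSucc) (m (Fin.last n)) with
      ⟨d, q, hd, hq⟩ | ⟨l, hl, hl0⟩
    -- Torsion case: adding `z` times the relation `d * m_last = ∑ q i * m i` reduces the last
    -- coefficient modulo `d` without changing the sum. Degree `a - c` makes its contribution have
    -- degree at most `a`. The degree of `z` is irrelevant, since induction rechooses the other
    -- coefficients.
    · refine ⟨N, hN, fun a y hy => ?_⟩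
      obtain ⟨z, hz⟩ := exists_div_degLE hd (y (Fin.last n)) (a - c)
      have e (j : J) : ∑ i : Fin n, (y i.castSucc + z * q i) * m i.castSucc j =
          ∑ i, y i * m i j - (y (Fin.last n) - z * d) * m (Fin.last n) j := by
        rw [Fin.sum_univ_castSucc]
        simp only [add_mul, Finset.sum_add_distrib, mul_assoc, ← Finset.mul_sum]
        rw [← hq]
        ring
      obtain ⟨y', h1, h2⟩ := ih a (fun i => y i.castSucc + z * q i) fun j => by
        rw [e]
        exact sub_mem (hy j) (degLE_mono (by linarith) (mul_mem_degLE hz (hm j)))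
      refine ⟨Fin.snoc y' (y (Fin.last n) - z * d), fun j => ?_, fun i => ?_⟩
      · rw [Fin.sum_univ_castSucc]
        simp only [Fin.snoc_castSucc, Fin.snoc_last]
        rw [h1, e, sub_add_cancel]
      · refine Fin.lastCases ?_ (fun i => ?_) i
        · rw [Fin.snoc_last]
          exact degLE_mono (by linarith) hz
        · rw [Fin.snoc_castSucc]
          exact h2 i
    -- Separated case: `l` kills all rows but the last, so it bounds the degree of the last
    -- coefficient itself. Here `c'` is the cost of applying `l`, `e` that of cancelling its value
    -- on the last row, and `c` that of moving the last term to the other side.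
    · obtain ⟨c', hc', hlc⟩ := exists_forall_mem_degLE l
      obtain ⟨e, he⟩ := exists_cancel_degLE hl0
      refine ⟨|c' + e| + c + N, by positivity, fun a y hy => ?_⟩
      have h0 : y (Fin.last n) ∈ degLE κ Γ (a + |c' + e|) := by
        have h1 := sum_mul_mem_degLE hy hlc
        have h2 : ∑ j, (∑ i, y i * m i j) * l j =
            (∑ j, m (Fin.last n) j * l j) * y (Fin.last n) := by
          simp only [Finset.sum_mul]
          rw [Finset.sum_comm, Fin.sum_univ_castSucc, Finset.sum_eq_zero, zero_add]
          · exact Finset.sum_congr rfl fun j _ => by ring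
          · intro i _
            simp only [mul_assoc, ← Finset.mul_sum]
            rw [hl, mul_zero]
        rw [h2] at h1
        refine degLE_mono ?_ (he _ _ h1)
        linarith [le_abs_self (c' + e)]
      have e' (j : J) : ∑ i : Fin n, y i.castSucc * m i.castSucc j =
          ∑ i, y i * m i j - y (Fin.last n) * m (Fin.last n) j := by
        rw [Fin.sum_univ_castSucc, add_sub_cancel_right]
      obtain ⟨y', h1, h2⟩ := ih (a + |c' + e| + c) (fun i => y i.castSucc) fun j => by
        rw [e']
        exact sub_mem (degLE_mono (by linarith [abs_nonneg (c' + e)]) (hy j))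
          (mul_mem_degLE h0 (hm j))
      refine ⟨Fin.snoc y' (y (Fin.last n)), fun j => ?_, fun i => ?_⟩
      · rw [Fin.sum_univ_castSucc]
        simp only [Fin.snoc_castSucc, Fin.snoc_last]
        rw [h1, e', sub_add_cancel]
      · refine Fin.lastCases ?_ (fun i => ?_) i
        · rw [Fin.snoc_last]
          exact degLE_mono (by linarith) h0
        · rw [Fin.snoc_castSucc]
          exact degLE_mono (by linarith) (h2 i)

end Filtration

/-! ### Equivariant chains over a finite set of simplices -/

section Equivariant

variable {κ : Type v} [Field κ] {Γ : AddSubgroup ℝ}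

theorem exists_strict_of_fintype {ι J : Type*} [Fintype ι] [Fintype J]
    (m : ι → J → AddMonoidAlgebra κ Γ) :
    ∃ N, 0 ≤ N ∧ ∀ (a : ℝ) (y : ι → AddMonoidAlgebra κ Γ),
      (∀ j, ∑ i, y i * m i j ∈ degLE κ Γ a) →
      ∃ y' : ι → AddMonoidAlgebra κ Γ, (∀ j, ∑ i, y' i * m i j = ∑ i, y i * m i j) ∧
        ∀ i, y' i ∈ degLE κ Γ (a + N) := by
  let e := Fintype.equivFin ι
  obtain ⟨N, hN, h⟩ := exists_strict _ fun i => m (e.symm i)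
  refine ⟨N, hN, fun a y hy => ?_⟩
  obtain ⟨y', h1, h2⟩ := h a (fun i => y (e.symm i)) fun j => by
    rw [e.symm.sum_comp (fun i => y i * m i j)]
    exact hy j
  refine ⟨fun i => y' (e i), fun j => ?_, fun i => h2 _⟩
  rw [← e.symm.sum_comp, ← e.symm.sum_comp (fun i => y i * m i j), ← h1]
  simp

variable {X X' : Type*} [TopologicalSpace X] [TopologicalSpace X'] [AddAction Γ X']
  [ContinuousConstVAdd Γ X'] {n k : ℕ}

/-- The action of `g` as a continuous map. -/
def translate (X' : Type*) [TopologicalSpace X'] [AddAction Γ X'] [ContinuousConstVAdd Γ X']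
    (g : Γ) : C(X', X') := ⟨fun x => g +ᵥ x, continuous_const_vadd g⟩

theorem translate_comp_translate (g h : Γ) (σ : C(Spx k, X')) :
    (translate X' g).comp ((translate X' h).comp σ) = (translate X' (g + h)).comp σ := by
  ext1 x
  exact (add_vadd g h (σ x)).symm

/-- The chain `p · σ` for an element `p` of the group ring. -/
def ringSMul (σ : C(Spx k, X')) : AddMonoidAlgebra κ Γ →+ Ch κ k X' :=
  (Finsupp.mapDomain.addMonoidHom fun γ : Γ => (translate X' γ).comp σ).comp
    (AddMonoidAlgebra.coeffAddEquiv : AddMonoidAlgebra κ Γ ≃+ (Γ →₀ κ)).toAddMonoidHom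

theorem ringSMul_single (σ : C(Spx k, X')) (g : Γ) (a : κ) :
    ringSMul σ (AddMonoidAlgebra.single g a) = Finsupp.single ((translate X' g).comp σ) a :=
  Finsupp.mapDomain_single

theorem ringSMul_translate (σ : C(Spx k, X')) (g : Γ) (p : AddMonoidAlgebra κ Γ) :
    ringSMul ((translate X' g).comp σ) p = ringSMul σ (p * AddMonoidAlgebra.single g 1) := by
  induction p using AddMonoidAlgebra.induction_linear with
  | zero => simp
  | add p q hp hq => rw [map_add, add_mul, map_add, hp, hq]
  | single h a =>
    rw [ringSMul_single, AddMonoidAlgebra.single_mul_single, ringSMul_single,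
      translate_comp_translate, mul_one]

theorem bd_ringSMul (σ : C(Spx (k + 1), X')) (p : AddMonoidAlgebra κ Γ) :
    bd κ k X' (ringSMul σ p) =
      ∑ i : Fin (k + 2), ((-1 : ℤ) ^ (i : ℕ)) • ringSMul (σ.comp (face i)) p := by
  induction p using AddMonoidAlgebra.induction_linear with
  | zero => simp
  | add p q hp hq => simp only [map_add, hp, hq, smul_add, Finset.sum_add_distrib]
  | single h a => simp only [ringSMul_single, bd_single, ContinuousMap.comp_assoc]

variable {π : C(X', X)} (hπ : IsAddQuotientCoveringMap π Γ)

include hπ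

/-- A deck transformation matches the two lifts at one point, and lifts of a connected space that
agree at a point coincide. -/
theorem exists_eq_translate {σ τ : C(Spx k, X')} (h : π.comp σ = π.comp τ) :
    ∃ g : Γ, τ = (translate X' g).comp σ := by
  let b : Spx k := Classical.arbitrary _
  obtain ⟨g, hg⟩ := hπ.apply_eq_iff_mem_orbit.1 (congrArg (· b) h).symm
  refine ⟨g, DFunLike.coe_injective (hπ.isCoveringMap.eq_of_comp_eq τ.continuous
    (ContinuousMap.continuous _) ?_ b hg.symm)⟩
  ext x
  refine (congrArg (· x) h).symm.trans ?_
  exact hπ.apply_eq_iff_mem_orbit.2 ⟨-g, neg_vadd_vadd g (σ x)⟩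

theorem translate_injective {σ : C(Spx k, X')} {g h : Γ}
    (e : (translate X' g).comp σ = (translate X' h).comp σ) : g = h := by
  let b : Spx k := Classical.arbitrary _
  have := hπ.isCancelVAdd
  exact IsCancelVAdd.right_cancel _ _ _ (congrArg (· b) e)

theorem comp_translate (σ : C(Spx k, X')) (g : Γ) : π.comp ((translate X' g).comp σ) = π.comp σ := by
  ext1 x
  exact hπ.apply_eq_iff_mem_orbit.2 ⟨g, rfl⟩

/-- Chains over a finite set of simplices of the base, closed under faces: every boundary is the
boundary of a chain at most a constant higher up. -/
theorem exists_bounded_of_finite (f : C(X', ℝ)) (hf : IsLift (Γ := Γ) f)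
    (T : ∀ k, Set C(Spx k, X)) (hT : ∀ k, (T k).Finite)
    (hface : ∀ k, ∀ τ ∈ T (k + 1), ∀ i, τ.comp (face i) ∈ T k) :
    ∃ N, 0 ≤ N ∧ ∀ (t : ℝ) (y : Ch κ (n + 1) X'),
      y ∈ Finsupp.supported κ κ {σ | π.comp σ ∈ T (n + 1)} →
      bd κ n X' y ∈ Finsupp.supported κ κ (within n {x | f x ≤ t}) →
      ∃ y', bd κ n X' y' = bd κ n X' y ∧
        y' ∈ Finsupp.supported κ κ (within (n + 1) {x | f x ≤ t + N}) := by
  classical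
  let L (k : ℕ) : Type _ := {τ : C(Spx k, X) // τ ∈ T k ∧ ∃ σ : C(Spx k, X'), π.comp σ = τ}
  have hfin (k : ℕ) : Finite (L k) := ((hT k).subset fun _ h => h.1 :
    {τ | τ ∈ T k ∧ ∃ σ : C(Spx k, X'), π.comp σ = τ}.Finite)
  have hfin' (k : ℕ) : Fintype (L k) := Fintype.ofFinite _
  choose s hs using fun k (θ : L k) => θ.2.2
  have hs' (k : ℕ) (σ : C(Spx k, X')) (h : π.comp σ ∈ T k) :
      ∃ (θ : L k) (g : Γ), σ = (translate X' g).comp (s k θ) := by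
    obtain ⟨g, hg⟩ := exists_eq_translate hπ (hs k ⟨π.comp σ, h, σ, rfl⟩)
    exact ⟨_, g, hg⟩
  have hinj (k : ℕ) {θ θ' : L k} {g g' : Γ}
      (h : (translate X' g).comp (s k θ) = (translate X' g').comp (s k θ')) : θ = θ' ∧ g = g' := by
    have h1 : θ = θ' := by
      have := congrArg π.comp h
      rw [comp_translate hπ, comp_translate hπ, hs, hs] at this
      exact Subtype.ext this
    subst h1
    exact ⟨rfl, translate_injective hπ h⟩
  -- By compactness and finiteness `f` is bounded on the chosen lifts, so the level of `γ · s`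
  -- differs from the degree `γ` by at most a constant.
  have hbound (k : ℕ) : ∃ c, ∀ θ x, |f (s k θ x)| ≤ c := by
    have (θ : L k) : ∃ c, ∀ x, |f (s k θ x)| ≤ c := by
      obtain ⟨c, hc⟩ := isCompact_univ.exists_bound_of_continuousOn
        ((f.comp (s k θ)).continuous.continuousOn)
      exact ⟨c, fun x => hc x trivial⟩
    choose c hc using this
    obtain ⟨c', hc'⟩ := (Set.finite_range c).bddAbove
    exact ⟨c', fun θ x => (hc θ x).trans (hc' ⟨θ, rfl⟩)⟩
  obtain ⟨c₁, hc₁⟩ := hbound (n + 1)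
  obtain ⟨c₀, hc₀⟩ := hbound n
  choose φ g hφ using fun (θ : L (n + 1)) (i : Fin (n + 2)) => hs' n ((s (n + 1) θ).comp (face i)) (by
    rw [← ContinuousMap.comp_assoc, hs]
    exact hface n _ θ.2.1 i)
  -- The matrix of the boundary operator: the `i`-th face of the chosen lift over `θ` is the
  -- translate by `g θ i` of the chosen lift over `φ θ i`.
  let m (θ : L (n + 1)) (η : L n) : AddMonoidAlgebra κ Γ :=
    ∑ i : Fin (n + 2), ((-1 : ℤ) ^ (i : ℕ)) • if φ θ i = η then .single (g θ i) 1 else 0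
  let Φ (k : ℕ) (Y : L k → AddMonoidAlgebra κ Γ) : Ch κ k X' := ∑ θ, ringSMul (s k θ) (Y θ)
  have hΦ (Y : L (n + 1) → AddMonoidAlgebra κ Γ) :
      bd κ n X' (Φ (n + 1) Y) = Φ n fun η => ∑ θ, Y θ * m θ η := by
    simp only [Φ, map_sum, bd_ringSMul]
    rw [Finset.sum_comm (s := (Finset.univ : Finset (L n)))]
    refine Finset.sum_congr rfl fun θ _ => ?_
    simp only [m, Finset.mul_sum, map_sum]
    rw [Finset.sum_comm]
    refine Finset.sum_congr rfl fun i _ => ?_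
    rw [hφ, ringSMul_translate]
    simp only [mul_smul_comm, map_zsmul, mul_ite, mul_zero]
    rw [← Finset.smul_sum, Finset.sum_eq_single (φ θ i)]
    · rw [if_pos rfl]
    · intro η _ hη
      rw [if_neg (Ne.symm hη), map_zero]
    · simp
  have hcoeff (k : ℕ) (Y : L k → AddMonoidAlgebra κ Γ) (θ : L k) (γ : Γ) :
      Φ k Y ((translate X' γ).comp (s k θ)) = (Y θ).coeff γ := by
    simp only [Φ, Finsupp.finsetSum_apply]
    rw [Finset.sum_eq_single θ]
    · exact Finsupp.mapDomain_apply (fun _ _ h => (hinj k h).2) _ _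
    · intro θ' _ hne
      refine Finsupp.mapDomain_of_notMem_range _ _ ?_
      rintro ⟨γ', h⟩
      exact hne (hinj k h).1
    · simp
  have hsurj (y : Ch κ (n + 1) X') (hy : y ∈ Finsupp.supported κ κ {σ | π.comp σ ∈ T (n + 1)}) :
      ∃ Y, Φ (n + 1) Y = y := by
    have hadd (Y Y' : L (n + 1) → AddMonoidAlgebra κ Γ) :
        Φ (n + 1) (Y + Y') = Φ (n + 1) Y + Φ (n + 1) Y' := by
      simp only [Φ, Pi.add_apply, map_add, Finset.sum_add_distrib]
    rw [← Finsupp.sum_single y, Finsupp.sum]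
    refine Finset.sum_induction _ (fun c => ∃ Y, Φ (n + 1) Y = c) ?_ ⟨0, by simp [Φ]⟩ ?_
    · rintro _ _ ⟨Y, rfl⟩ ⟨Y', rfl⟩
      exact ⟨_, hadd Y Y'⟩
    · intro σ hσ
      obtain ⟨θ, g, h⟩ := hs' (n + 1) σ (hy hσ)
      refine ⟨Pi.single θ (.single g (y σ)), ?_⟩
      simp only [Φ]
      rw [Finset.sum_eq_single θ]
      · rw [Pi.single_eq_same, ringSMul_single, ← h]
      · intro θ' _ hne
        rw [Pi.single_eq_of_ne hne, map_zero]
      · simp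
  obtain ⟨N, hN, hstrict⟩ := exists_strict_of_fintype m
  -- Passing from level to degree costs `c₀`, strictness costs `N`, and returning to level costs
  -- `c₁`.
  refine ⟨|c₀| + N + |c₁|, by positivity, fun t y hy hyt => ?_⟩
  obtain ⟨Y, rfl⟩ := hsurj y hy
  obtain ⟨Y', h1, h2⟩ := hstrict (t + c₀) Y fun η γ hγ => by
    have hmem : (translate X' γ).comp (s n η) ∈ (bd κ n X' (Φ (n + 1) Y)).support := by
      rw [Finsupp.mem_support_iff, hΦ, hcoeff]
      exact Finsupp.mem_support_iff.1 hγ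
    have h := hyt hmem (Classical.arbitrary _)
    have h' : f (γ +ᵥ s n η (Classical.arbitrary _)) ≤ t := h
    rw [hf] at h'
    linarith [(abs_le.1 (hc₀ η (Classical.arbitrary _))).1]
  refine ⟨Φ (n + 1) Y', by rw [hΦ, hΦ]; simp only [h1], ?_⟩
  refine Submodule.sum_mem _ fun θ _ => ?_
  intro σ hσ x
  obtain ⟨γ, hγ, rfl⟩ := Finset.mem_image.1 (Finsupp.mapDomain_support hσ)
  change f (γ +ᵥ s (n + 1) θ x) ≤ _
  rw [hf]
  linarith [h2 θ γ hγ, (abs_le.1 (hc₁ θ x)).2, le_abs_self c₀, le_abs_self c₁]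

end Equivariant

/-! ### Straightening small simplices in a compact ANR -/

section Geometry

variable {Γ : AddSubgroup ℝ} {X X' : Type u} [TopologicalSpace X] [TopologicalSpace X']
  [AddAction Γ X'] {π : C(X', X)} {n : ℕ}

/-- Every point of the base has a neighbourhood such that the lift `f` of the closed 1-form varies
by at most `1` along paths over it. -/
theorem exists_nhd_variation_le (hπ : IsAddQuotientCoveringMap π Γ) {f : C(X', ℝ)}
    (hf : IsLift (Γ := Γ) f) (x : X) :
    ∃ V : Set X, IsOpen V ∧ x ∈ V ∧ ∀ γ : C(unitInterval, X'), (∀ s, π (γ s) ∈ V) →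
      ∀ s, |f (γ s) - f (γ 0)| ≤ 1 := by
  have := hπ.toContinuousConstVAdd
  obtain ⟨p, rfl⟩ := hπ.surjective x
  obtain ⟨e, hp, he⟩ := hπ.isCoveringMap.isLocalHomeomorph p
  have he' (y : X') : π y = e y := congrFun he y
  -- A piece of one sheet on which `f` stays within `1 / 2` of `f p`. A path over its image lies in
  -- a single translate of `O`, and translation changes `f` only by an additive constant.
  let O : Set X' := e.source ∩ f ⁻¹' Metric.ball (f p) (1 / 2)
  have hO : IsOpen O := e.open_source.inter (Metric.isOpen_ball.preimage f.continuous)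
  refine ⟨e '' O, e.isOpen_image_of_subset_source hO Set.inter_subset_left,
    ⟨p, ⟨hp, Metric.mem_ball_self (by norm_num)⟩, (he' p).symm⟩, fun γ hγ => ?_⟩
  choose o ho heo using hγ
  have hsymm (s : unitInterval) : e.symm (π (γ s)) = o s := by
    rw [← heo, e.left_inv (ho s).1]
  have hoc : Continuous o := by
    rw [← funext hsymm]
    refine e.continuousOn_symm.comp_continuous (π.continuous.comp γ.continuous) fun s => ?_
    rw [← heo]
    exact e.map_source (ho s).1
  obtain ⟨g, hg⟩ := (hπ.apply_eq_iff_mem_orbit (e₁ := γ 0) (e₂ := o 0)).1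
    (by rw [he' (o 0), heo])
  have key : (fun s => g +ᵥ o s) = γ := by
    refine hπ.isCoveringMap.eq_of_comp_eq (hoc.const_vadd g) γ.continuous ?_ 0 hg
    ext s
    refine Eq.trans (hπ.apply_eq_iff_mem_orbit.2 ⟨g, rfl⟩) ?_
    rw [he' (o s), heo]
    rfl
  intro s
  rw [← congrFun key s, ← congrFun key 0, hf, hf, add_sub_add_right_eq_sub]
  have h1 := (ho s).2
  have h2 := (ho 0).2
  rw [Set.mem_preimage, Metric.mem_ball, Real.dist_eq, abs_lt] at h1 h2
  rw [abs_le]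
  constructor <;> linarith [h1.1, h1.2, h2.1, h2.2]

/-- A compact ANR is embedded in a normed space as a retract of an open neighbourhood. -/
theorem IsANR.exists_retraction [CompactSpace X] (hX : IsANR X) :
    ∃ (B : Type u) (_ : NormedAddCommGroup B) (_ : NormedSpace ℝ B) (j : C(X, B)) (U : Set B)
      (ρ : C(U, X)), IsOpen U ∧ ∀ x, ∃ h : j x ∈ U, ρ ⟨j x, h⟩ = x := by
  obtain ⟨hm, hX⟩ := hX
  let _ : MetricSpace X := TopologicalSpace.metrizableSpaceMetric X
  let d : C(X × X, ℝ) := ⟨fun p => dist p.1 p.2, continuous_dist⟩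
  -- The Kuratowski embedding, sending a point to its distance function.
  let j : C(X, C(X, ℝ)) := d.curry
  have hj : Function.Injective j := by
    intro x y h
    have : dist x y = dist y y := congrArg (· y) h
    rwa [dist_self, dist_eq_zero] at this
  obtain ⟨U, hU, hjU, ρ, hρ⟩ := hX C(X, ℝ) j (j.continuous.isClosedEmbedding hj)
  exact ⟨C(X, ℝ), inferInstance, inferInstance, j, U, ρ, hU, fun x =>
    ⟨hjU ⟨x, rfl⟩, hρ x _⟩⟩

variable {B : Type*} [NormedAddCommGroup B] [NormedSpace ℝ B]

/-- The straight-line homotopy from `σ` to the affine simplex with vertices `q i`. -/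
def straighten (σ : C(Spx n, B)) (q : Fin (n + 1) → B) : C(unitInterval × Spx n, B) where
  toFun a := (1 - a.1 : ℝ) • σ a.2 + (a.1 : ℝ) • ∑ i, a.2.1 i • q i
  continuous_toFun := by
    have h1 : Continuous fun a : unitInterval × Spx n => (a.1 : ℝ) :=
      continuous_subtype_val.comp continuous_fst
    have h2 (i : Fin (n + 1)) : Continuous fun a : unitInterval × Spx n => a.2.1 i :=
      (continuous_apply i).comp (continuous_subtype_val.comp continuous_snd)
    exact ((continuous_const.sub h1).smul (σ.continuous.comp continuous_snd)).add
      (h1.smul (continuous_finsetSum _ fun i _ => (h2 i).smul continuous_const))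

/-- All `q i` and `σ t` lie in the ball of radius `ε` about `σ t`, by two estimates of `ε / 2`;
balls are convex. -/
theorem norm_straighten_sub_lt (σ : C(Spx n, B)) (q : Fin (n + 1) → B) {ε : ℝ}
    (hσ : ∀ x y, dist (σ x) (σ y) < ε / 2) (hq : ∀ i, dist (q i) (σ (stdSimplex.vertex i)) < ε / 2)
    (s : unitInterval) (t : Spx n) : straighten σ q (s, t) ∈ Metric.ball (σ t) ε := by
  have h1 : (∑ i, t.1 i • q i) ∈ Metric.ball (σ t) ε := by
    refine (convex_ball (σ t) ε).sum_mem (fun i _ => t.2.1 i) t.2.2 fun i _ => ?_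
    have := dist_triangle (q i) (σ (stdSimplex.vertex i)) (σ t)
    rw [Metric.mem_ball]
    linarith [hq i, hσ (stdSimplex.vertex i) t]
  have h2 : σ t ∈ Metric.ball (σ t) ε := by
    refine Metric.mem_ball_self ?_
    have := (dist_nonneg).trans_lt (hσ t t)
    linarith
  exact convex_ball (σ t) ε h2 h1 (by linarith [s.2.2]) s.2.1 (by ring)

theorem straighten_face (σ : C(Spx (n + 1), B)) (q : Fin (n + 2) → B) (i : Fin (n + 2)) :
    (straighten σ q).comp (pface i) = straighten (σ.comp (face i)) (fun k => q (i.succAbove k)) := by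
  ext1 ⟨s, t⟩
  change (1 - s : ℝ) • σ (face i t) + (s : ℝ) • ∑ j, (face i t).1 j • q j = _
  rw [sum_face]
  rfl

/-- Small simplices of the covering are homotopic, naturally and with bounded variation of `f`, to
simplices which lie over a finite set of simplices of the base. -/
theorem exists_straightening [CompactSpace X] (hX : IsANR X)
    (hπ : IsAddQuotientCoveringMap π Γ) {f : C(X', ℝ)} (hf : IsLift (Γ := Γ) f) :
    ∃ (G : ∀ k, Set C(Spx k, X')) (T : ∀ k, Set C(Spx k, X))
      (F : ∀ k, C(Spx k, X') → C(unitInterval × Spx k, X')),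
      (∀ {m : ℕ} (σ : C(Spx m, X')), ∃ ε > 0, ∀ {k : ℕ}, ∀ τ ∈ smallSpx k (Spx m) ε,
        σ.comp τ ∈ G k) ∧
      (∀ k, (T k).Finite) ∧ (∀ k, ∀ τ ∈ T (k + 1), ∀ i, τ.comp (face i) ∈ T k) ∧
      (∀ k, ∀ σ ∈ G (k + 1), ∀ i, σ.comp (face i) ∈ G k) ∧
      (∀ k, ∀ σ ∈ G (k + 1), ∀ i, (F (k + 1) σ).comp (pface i) = F k (σ.comp (face i))) ∧
      (∀ k, ∀ σ ∈ G k, (F k σ).comp (inclAt k 0) = σ) ∧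
      (∀ k, ∀ σ ∈ G k, π.comp ((F k σ).comp (inclAt k 1)) ∈ T k) ∧
      ∀ k, ∀ σ ∈ G k, ∀ s t, |f (F k σ (s, t)) - f (σ t)| ≤ 1 := by
  classical
  obtain ⟨B, _, _, j, U, ρ, hU, hρ⟩ := hX.exists_retraction
  choose V hVo hxV hV using exists_nhd_variation_le hπ hf
  -- The Lebesgue number makes every `ε`-ball about a point of `j(X)` lie in `U` and retract into a
  -- single `V x`.
  obtain ⟨ε, hε, hLeb⟩ := lebesgue_number_lemma_of_metric (isCompact_range j.continuous)
    (c := fun x => Subtype.val '' (ρ ⁻¹' V x))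
    (fun x => hU.isOpenMap_subtype_val _ ((hVo x).preimage ρ.continuous)) (by
      rintro _ ⟨x, rfl⟩
      obtain ⟨h, hx⟩ := hρ x
      exact Set.mem_iUnion.2 ⟨x, ⟨j x, h⟩, by rw [Set.mem_preimage, hx]; exact hxV x, rfl⟩)
  obtain ⟨Q, -, hQ, hcover⟩ := (isCompact_range j.continuous).finite_cover_balls (half_pos hε)
  have hp (x : X) : ∃ q ∈ Q, dist q (j x) < ε / 2 := by
    obtain ⟨q, hq, h⟩ := Set.mem_iUnion₂.1 (hcover ⟨x, rfl⟩)
    exact ⟨q, hq, (dist_comm _ _).trans_lt h⟩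
  -- The nearby net point depends only on the point of `X`, so simplices sharing a face straighten
  -- it in the same way.
  choose p hpQ hp using hp
  let jπ : C(X', B) := j.comp π
  let G (k : ℕ) : Set C(Spx k, X') := {σ | ∀ x y, dist (jπ (σ x)) (jπ (σ y)) < ε / 2}
  -- Retracted affine simplices with vertices in the finite net `Q`; the vertices determine the
  -- simplex, whence finiteness.
  let T (k : ℕ) : Set C(Spx k, X) := {τ | ∃ q : Fin (k + 1) → Q,
    ∀ t : Spx k, ∃ h : ∑ i, t.1 i • (q i : B) ∈ U, τ t = ρ ⟨_, h⟩}
  let HB (k : ℕ) (σ : C(Spx k, X')) : C(unitInterval × Spx k, B) :=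
    straighten (jπ.comp σ) fun i => p (π (σ (stdSimplex.vertex i)))
  have hHB (k : ℕ) (σ : C(Spx k, X')) (hσ : σ ∈ G k) (t : Spx k) :
      ∃ x, ∀ s, ∃ h : HB k σ (s, t) ∈ U, ρ ⟨_, h⟩ ∈ V x := by
    obtain ⟨x, hx⟩ := hLeb (jπ (σ t)) ⟨_, rfl⟩
    refine ⟨x, fun s => ?_⟩
    obtain ⟨⟨u, hu⟩, h1, h2⟩ := hx (norm_straighten_sub_lt (jπ.comp σ) _ hσ (fun i => hp _) s t)
    subst h2
    exact ⟨hu, h1⟩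
  have hHU (k : ℕ) (σ : C(Spx k, X')) (hσ : σ ∈ G k) (a : unitInterval × Spx k) : HB k σ a ∈ U :=
    ((hHB k σ hσ a.2).choose_spec a.1).choose
  let HX (k : ℕ) (σ : C(Spx k, X')) (hσ : σ ∈ G k) : C(unitInterval × Spx k, X) :=
    ρ.comp ⟨fun a => ⟨HB k σ a, hHU k σ hσ a⟩, (HB k σ).continuous.subtype_mk _⟩
  have hHX0 (k : ℕ) (σ : C(Spx k, X')) (hσ : σ ∈ G k) (t : Spx k) :
      HX k σ hσ (0, t) = π (σ t) := by
    obtain ⟨h, hx⟩ := hρ (π (σ t))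
    refine Eq.trans ?_ hx
    refine congrArg ρ (Subtype.ext ?_)
    simp [HB, straighten, jπ]
  let F (k : ℕ) (σ : C(Spx k, X')) : C(unitInterval × Spx k, X') :=
    if hσ : σ ∈ G k then hπ.isCoveringMap.liftHomotopy (HX k σ hσ) σ (hHX0 k σ hσ)
    else σ.comp ContinuousMap.snd
  have hF {k : ℕ} {σ : C(Spx k, X')} (hσ : σ ∈ G k) :
      F k σ = hπ.isCoveringMap.liftHomotopy (HX k σ hσ) σ (hHX0 k σ hσ) := dif_pos hσ
  have hFπ {k : ℕ} {σ : C(Spx k, X')} (hσ : σ ∈ G k) (a : unitInterval × Spx k) :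
      π (F k σ a) = HX k σ hσ a := by
    rw [hF hσ]
    exact congrFun (hπ.isCoveringMap.liftHomotopy_lifts (HX k σ hσ) σ (hHX0 k σ hσ)) a
  have hF0 {k : ℕ} {σ : C(Spx k, X')} (hσ : σ ∈ G k) (t : Spx k) : F k σ (0, t) = σ t := by
    rw [hF hσ]
    exact hπ.isCoveringMap.liftHomotopy_zero (HX k σ hσ) σ (hHX0 k σ hσ) t
  have hGface (k : ℕ) (σ : C(Spx (k + 1), X')) (hσ : σ ∈ G (k + 1)) (i : Fin (k + 2)) :
      σ.comp (face i) ∈ G k := fun x y => hσ _ _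
  refine ⟨G, T, F, ?_, ?_, ?_, hGface, ?_, ?_, ?_, ?_⟩
  · intro m σ
    obtain ⟨δ, hδ, h⟩ := Metric.uniformContinuous_iff.1
      (CompactSpace.uniformContinuous_of_continuous (jπ.comp σ).continuous) _ (half_pos hε)
    refine ⟨δ, hδ, ?_⟩
    rintro k τ ⟨d, hd, hτ⟩ x y
    exact h ((hτ x y).trans_lt hd)
  · intro k
    have : Finite Q := hQ
    refine Set.Finite.of_injOn (f := fun τ : C(Spx k, X) =>
      {q : Fin (k + 1) → Q | ∀ t : Spx k, ∃ h : ∑ i, t.1 i • (q i : B) ∈ U, τ t = ρ ⟨_, h⟩})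
      (t := Set.univ) (fun _ _ => trivial) ?_ Set.finite_univ
    rintro τ ⟨q, hq⟩ τ' - h
    have hq' : ∀ t : Spx k, ∃ h : ∑ i, t.1 i • (q i : B) ∈ U, τ' t = ρ ⟨_, h⟩ :=
      (Set.ext_iff.1 h q).1 hq
    ext1 t
    rw [(hq t).choose_spec, (hq' t).choose_spec]
  · rintro k τ ⟨q, hq⟩ i
    refine ⟨fun a => q (i.succAbove a), fun t => ?_⟩
    obtain ⟨h, ht⟩ := hq (face i t)
    have e := sum_face i t fun a => (q a : B)
    exact ⟨e ▸ h, ht.trans (congrArg ρ (Subtype.ext e))⟩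
  · intro k σ hσ i
    -- Lifts of homotopies are unique, so compatibility with faces may be checked in `X` and at time
    -- `0`.
    rw [hF (hGface k σ hσ i), hπ.isCoveringMap.eq_liftHomotopy_iff']
    refine ⟨?_, fun t => hF0 hσ _⟩
    ext a
    refine (hFπ hσ (pface i a)).trans (congrArg ρ (Subtype.ext ?_))
    have e := straighten_face (jπ.comp σ) (fun i => p (π (σ (stdSimplex.vertex i)))) i
    refine (congrArg (· a) e).trans ?_
    simp only [HB]
    congr 2
    ext1 b
    change p (π (σ (stdSimplex.vertex _))) = p (π (σ (face i (stdSimplex.vertex b))))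
    rw [face_vertex]
  · intro k σ hσ
    ext1 t
    exact hF0 hσ t
  · intro k σ hσ
    refine ⟨fun i => ⟨p (π (σ (stdSimplex.vertex i))), hpQ _⟩, fun t => ?_⟩
    have e : HB k σ (1, t) = ∑ i, t.1 i • p (π (σ (stdSimplex.vertex i))) := by
      simp [HB, straighten]
    exact ⟨e ▸ hHU k σ hσ (1, t), (hFπ hσ (1, t)).trans (congrArg ρ (Subtype.ext e))⟩
  · intro k σ hσ s t
    -- For fixed `t` the whole track of the homotopy lies over one `V x`, where `f` varies by at
    -- most `1` along paths.
    obtain ⟨x, hx⟩ := hHB k σ hσ t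
    have h := hV x ((F k σ).comp ((ContinuousMap.id _).prodMk (ContinuousMap.const _ t)))
      (fun s => by
        obtain ⟨h1, h2⟩ := hx s
        change π (F k σ (s, t)) ∈ _
        rw [hFπ hσ]
        exact h2) s
    change |f (F k σ (s, t)) - f (F k σ (0, t))| ≤ 1 at h
    rwa [hF0 hσ] at h

end Geometry

/-! ### The uniform bound for boundaries and for homology classes -/

section Uniform

variable {κ : Type v} [Field κ] {Γ : AddSubgroup ℝ} {X X' : Type u} [TopologicalSpace X]
  [TopologicalSpace X'] [AddAction Γ X'] {π : C(X', X)}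

theorem bd_mapDomain {S : ∀ k, Set C(Spx k, X')} {Y : Type*} [TopologicalSpace Y]
    {g : ∀ k, C(Spx k, X') → C(Spx k, Y)} {n : ℕ}
    (hg : ∀ σ ∈ S (n + 1), ∀ i, (g (n + 1) σ).comp (face i) = g n (σ.comp (face i)))
    {z : Ch κ (n + 1) X'} (hz : z ∈ Finsupp.supported κ κ (S (n + 1))) :
    bd κ n Y (Finsupp.mapDomain (g (n + 1)) z) = Finsupp.mapDomain (g n) (bd κ n X' z) := by
  have h1 (k : ℕ) (z : Ch κ k X') : op (g k) (iota κ k) z = Finsupp.mapDomain (g k) z := by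
    rw [← push_id (iota κ k), op_iota]
    rfl
  rw [← h1, ← h1, op_bd, bd_iota]
  exact op_cosum hg _ hz

theorem mapDomain_mem_supported {Y : Type*} [TopologicalSpace Y] {n : ℕ}
    {g : C(Spx n, X') → C(Spx n, Y)} {S : Set C(Spx n, X')} {S' : Set C(Spx n, Y)}
    (hg : ∀ σ ∈ S, g σ ∈ S') {z : Ch κ n X'} (hz : z ∈ Finsupp.supported κ κ S) :
    Finsupp.mapDomain g z ∈ Finsupp.supported κ κ S' := by
  classical
  intro τ hτ
  obtain ⟨σ, hσ, rfl⟩ := Finset.mem_image.1 (Finsupp.mapDomain_support hτ)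
  exact hg σ (hz hσ)

/-- A boundary in the covering which lies in a sublevel set bounds a constant higher up. -/
theorem exists_uniform_bound [CompactSpace X] (hX : IsANR X)
    (hπ : IsAddQuotientCoveringMap π Γ) {f : C(X', ℝ)} (hf : IsLift (Γ := Γ) f) (n : ℕ) :
    ∃ N, 0 ≤ N ∧ ∀ (t : ℝ) (w : Ch κ (n + 1) X'),
      bd κ n X' w ∈ Finsupp.supported κ κ (within n {x | f x ≤ t}) →
      ∃ w', bd κ n X' w' = bd κ n X' w ∧
        w' ∈ Finsupp.supported κ κ (within (n + 1) {x | f x ≤ t + N}) := by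
  have := hπ.toContinuousConstVAdd
  obtain ⟨G, T, F, hG, hT, hTface, hGface, hFface, hF0, hF1, hFf⟩ := exists_straightening hX hπ hf
  obtain ⟨N, hN, hbound⟩ := exists_bounded_of_finite (κ := κ) (n := n) hπ f hf T hT hTface
  -- The extra `1` is the variation of `f` under straightening.
  refine ⟨N + 1, by positivity, fun t w hw => ?_⟩
  obtain ⟨w₁, h, hw₁, hz₁, hh, hA⟩ := exists_small_chains G hG w
  obtain ⟨hz₁t, hht⟩ := hA _ hw
  obtain ⟨h', hh', hs'⟩ := exists_bd_eq_of_homotopy G F hFface (isCyc_bd w₁) hz₁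
  have hh't : h' ∈ Finsupp.supported κ κ (within (n + 1) {x | f x ≤ t + 1}) := by
    refine hs' _ _ hz₁t fun σ hσ τ x => ?_
    have h1 := (abs_le.1 (hFf n σ hσ.2 (τ x).1 (τ x).2)).2
    have h2 : f (σ (τ x).2) ≤ t := hσ.1 _
    change f (F n σ (τ x)) ≤ t + 1
    linarith
  have e0 : Finsupp.mapDomain (fun σ => (F n σ).comp (inclAt n 0)) (bd κ n X' w₁) =
      bd κ n X' w₁ := by
    refine (Finsupp.mapDomain_congr fun σ hσ => ?_).trans Finsupp.mapDomain_id
    exact hF0 n σ (hz₁ hσ)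
  have e1 : Finsupp.mapDomain (fun σ => (F n σ).comp (inclAt n 1)) (bd κ n X' w₁) =
      bd κ n X' (Finsupp.mapDomain (fun σ => (F (n + 1) σ).comp (inclAt (n + 1) 1)) w₁) := by
    refine (bd_mapDomain (S := G) (g := fun n σ => (F n σ).comp (inclAt n 1))
      (fun σ hσ i => ?_) hw₁).symm
    rw [← hFface n σ hσ i]
    rfl
  obtain ⟨y, hy, hyt⟩ := hbound (t + 1)
    (Finsupp.mapDomain (fun σ => (F (n + 1) σ).comp (inclAt (n + 1) 1)) w₁)
    (mapDomain_mem_supported (S' := {σ | π.comp σ ∈ T (n + 1)}) (hF1 (n + 1)) hw₁) (by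
      rw [← e1]
      refine mapDomain_mem_supported (g := fun σ => (F n σ).comp (inclAt n 1))
        (S := within n {x | f x ≤ t} ∩ G n) (S' := within n {x | f x ≤ t + 1}) (fun σ hσ x => ?_)
        fun σ hσ => ⟨hz₁t hσ, hz₁ hσ⟩
      have h1 := (abs_le.1 (hFf n σ hσ.2 1 x)).2
      have h2 : f (σ x) ≤ t := hσ.1 x
      change f (F n σ (1, x)) ≤ t + 1
      linarith)
  have hmono {a b : ℝ} (hab : a ≤ b) : within (n + 1) {x | f x ≤ a} ⊆ within (n + 1) {x | f x ≤ b} :=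
    fun σ hσ x => (hσ x).trans hab
  -- Here `h` joins `bd w` to the fine cycle `bd w₁`, `h'` joins that to its straightening, and `y`
  -- is a low chain filling the straightened cycle.
  refine ⟨h + y - h', ?_, Submodule.sub_mem _ (Submodule.add_mem _ ?_ ?_) ?_⟩
  · rw [map_sub, map_add, hh, hy, hh', e0, e1]
    abel
  · exact Finsupp.supported_mono (hmono (by linarith)) hht
  · exact Finsupp.supported_mono (hmono (by linarith)) hyt
  · exact Finsupp.supported_mono (hmono (by linarith)) hh't

theorem exists_push_subToAll {f : C(X', ℝ)} {t : ℝ} {n : ℕ} {w : Ch κ n X'}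
    (hw : w ∈ Finsupp.supported κ κ (within n {x | f x ≤ t})) :
    ∃ w' : Ch κ n (Sub f t), push κ (subToAll f t) w' = w := by
  rw [← Finsupp.sum_single w, Finsupp.sum]
  refine Finset.sum_induction _ (fun c => ∃ w', push κ (subToAll f t) w' = c) ?_
    ⟨0, map_zero _⟩ ?_
  · rintro _ _ ⟨a, rfl⟩ ⟨b, rfl⟩
    exact ⟨a + b, map_add _ _ _⟩
  · intro σ hσ
    exact ⟨Finsupp.single ⟨fun x => ⟨σ x, hw hσ x⟩, σ.continuous.subtype_mk _⟩ (w σ),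
      push_single _ _ _⟩

theorem push_subToAll_injective (f : C(X', ℝ)) (t : ℝ) (n : ℕ) :
    Function.Injective (push κ (n := n) (subToAll f t)) := by
  refine Finsupp.mapDomain_injective fun σ τ h => ?_
  ext1 x
  exact Subtype.ext (congrArg (· x) h)

/-- A class in a sublevel set which vanishes in the covering vanishes a constant higher up. -/
theorem exists_levelMap_eq_zero [CompactSpace X] (hX : IsANR X)
    (hπ : IsAddQuotientCoveringMap π Γ) {f : C(X', ℝ)} (hf : IsLift (Γ := Γ) f) (r : ℕ) :
    ∃ (N : ℝ) (hN : 0 ≤ N), ∀ (t : ℝ) (x : H κ r (Sub f t)), toAll f κ r t x = 0 →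
      levelMap f κ r (le_add_of_nonneg_right hN : t ≤ t + N) x = 0 := by
  obtain ⟨N, hN, h⟩ := exists_uniform_bound (κ := κ) hX hπ hf r
  refine ⟨N, hN, fun t x hx => ?_⟩
  obtain ⟨z, hz⟩ := exists_rep x
  obtain ⟨w, hw⟩ := ((hz.map (subToAll f t)).eq_zero_iff).1 hx
  obtain ⟨w', hw', hwt⟩ := h t w (by
    rw [hw]
    exact push_mem_supported (S := Set.univ) (fun σ _ x => (σ x).2) (mem_supported_univ z))
  obtain ⟨w'', rfl⟩ := exists_push_subToAll hwt
  refine ((hz.map (subIncl f _)).eq_zero_iff).2 ⟨w'', push_subToAll_injective f _ r ?_⟩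
  rw [push_bd, hw', hw, push_push]
  rfl

end Uniform

/-! ### The outer vertical arrows are isomorphisms -/

section Arrows

variable {X' : Type u} [TopologicalSpace X'] {f : C(X', ℝ)} {κ : Type v} [Field κ] {r : ℕ} {N : ℝ}

/-- Classes in sublevel sets which vanish in the whole space vanish after raising the level
by `N`. -/
def DiesAfter (f : C(X', ℝ)) (κ : Type v) [Field κ] (r : ℕ) (N : ℝ) : Prop :=
  ∀ ⦃s t : ℝ⦄ (h : s ≤ t), s + N ≤ t → ∀ x : H κ r (Sub f s), toAll f κ r s x = 0 →
    levelMap f κ r h x = 0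

theorem exists_diesAfter {Γ : AddSubgroup ℝ} {X : Type u} [TopologicalSpace X] [AddAction Γ X']
    [CompactSpace X] (hX : IsANR X) {π : C(X', X)} (hπ : IsAddQuotientCoveringMap π Γ)
    (hf : IsLift (Γ := Γ) f) (κ : Type v) [Field κ] (r : ℕ) :
    ∃ N, 0 ≤ N ∧ DiesAfter f κ r N := by
  obtain ⟨N, hN, h⟩ := exists_levelMap_eq_zero (κ := κ) hX hπ hf r
  refine ⟨N, hN, fun s t hst hs x hx => ?_⟩
  rw [← levelMap_levelMap f κ r (le_add_of_nonneg_right hN) hs, h s x hx, map_zero]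

/-- At the higher of the two levels the difference of the classes dies in `X'`, hence it dies by
level `t`. -/
theorem DiesAfter.levelMap_eq (hd : DiesAfter f κ r N) {s s' t : ℝ} (h : s ≤ t) (h' : s' ≤ t)
    (hs : s + N ≤ t) (hs' : s' + N ≤ t) {x : H κ r (Sub f s)} {x' : H κ r (Sub f s')}
    (hx : toAll f κ r s x = toAll f κ r s' x') :
    levelMap f κ r h x = levelMap f κ r h' x' := by
  wlog hss : s ≤ s' generalizing s s'
  · exact (this h' h hs' hs hx.symm (le_of_not_ge hss)).symm
  rw [← levelMap_levelMap f κ r hss h', ← sub_eq_zero, ← map_sub]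
  exact hd h' hs' _ (by rw [map_sub, toAll_levelMap, hx, sub_self])

variable (a : ℝ)

theorem leftArrow_coe (x : invLim f κ r a) :
    (leftArrow f κ r a x : H κ r X') = toAll f κ r a (invLimTo f κ r a x) := rfl

/-- The member at level `t` comes from the member at level `t - N`, whose class in `X'` is zero. -/
theorem DiesAfter.leftArrow_injective (hd : DiesAfter f κ r N) (hN : 0 ≤ N) :
    Function.Injective (leftArrow f κ r a) := by
  refine (injective_iff_map_eq_zero _).2 fun x hx => Subtype.ext (funext fun t => ?_)
  have hta : (t : ℝ) - N < a := lt_of_le_of_lt (sub_le_self _ hN) t.2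
  have hx' : toAll f κ r a (invLimTo f κ r a x) = 0 := congrArg Subtype.val hx
  rw [invLimTo_eq f κ r a x ⟨t - N, hta⟩, toAll_levelMap] at hx'
  have h : (⟨t - N, hta⟩ : Set.Iio a) ≤ t := show (t : ℝ) - N ≤ t from sub_le_self _ hN
  rw [← x.2 _ _ h]
  exact hd _ (sub_add_cancel _ _).le _ hx'

theorem DiesAfter.leftArrow_surjective (hd : DiesAfter f κ r N) (hN : 0 ≤ N) :
    Function.Surjective (leftArrow f κ r a) := by
  intro y
  choose z hz using fun t => (Submodule.mem_iInf _).1 y.2 t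
  -- Arbitrary preimages chosen at level `t - N` become compatible once raised by `N`.
  let x : invLim f κ r a := ⟨fun t => levelMap f κ r (sub_le_self (t : ℝ) hN) (z (t - N)), by
    intro s t h
    have hst : (s : ℝ) ≤ t := h
    rw [levelMap_levelMap]
    exact hd.levelMap_eq _ _ (by linarith) (by linarith) ((hz _).trans (hz _).symm)⟩
  refine ⟨x, Subtype.ext ?_⟩
  rw [leftArrow_coe, invLimTo_eq f κ r a x ⟨a - 1, sub_one_lt a⟩, toAll_levelMap]
  exact (toAll_levelMap f κ r _ _).trans (hz _)

theorem DiesAfter.leftArrow_bijective (hd : DiesAfter f κ r N) (hN : 0 ≤ N) :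
    Function.Bijective (leftArrow f κ r a) :=
  ⟨hd.leftArrow_injective a hN, hd.leftArrow_surjective a hN⟩

open Classical in
theorem rightArrow_of (t : Set.Ioi a) (x : H κ r (Sub f t)) :
    (rightArrow f κ r a (Module.DirectLimit.of κ (Set.Ioi a) (fun t => H κ r (Sub f t))
      (fun _ _ h => levelMap f κ r h) t x) : H κ r X') = toAll f κ r t x :=
  Module.DirectLimit.lift_of _ _ _

theorem rightArrow_toDirLim (y : H κ r (Sub f a)) :
    rightArrow f κ r a (toDirLim f κ r a y) =
      Submodule.inclusion (le_imgTop f κ r a) (middleArrow f κ r a y) := by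
  refine Subtype.ext ?_
  rw [toDirLim_eq f κ r a y ⟨a + 1, lt_add_one a⟩, rightArrow_of, toAll_levelMap]
  rfl

theorem DiesAfter.rightArrow_bijective (hd : DiesAfter f κ r N) (hN : 0 ≤ N) :
    Function.Bijective (rightArrow f κ r a) := by
  classical
  have : Nonempty (Set.Ioi a) := ⟨⟨a + 1, lt_add_one a⟩⟩
  refine ⟨(injective_iff_map_eq_zero _).2 fun z hz => ?_, fun y => ?_⟩
  · obtain ⟨t, x, rfl⟩ := Module.DirectLimit.exists_of z
    have hx : toAll f κ r t x = 0 := (rightArrow_of a t x).symm.trans (congrArg Subtype.val hz)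
    have hta : a < (t : ℝ) + N := lt_of_lt_of_le t.2 (le_add_of_nonneg_right hN)
    have h : t ≤ (⟨t + N, hta⟩ : Set.Ioi a) :=
      show (t : ℝ) ≤ t + N from le_add_of_nonneg_right hN
    have h0 : levelMap f κ r h x = 0 := hd _ le_rfl _ hx
    refine (Module.DirectLimit.of_f (hij := h)).symm.trans ?_
    rw [h0, map_zero]
  · obtain ⟨t, x, hx⟩ := Set.mem_iUnion.1 y.2
    -- The index system contains only levels above `a`, so the level of the given class may have to
    -- be raised.
    let t' : Set.Ioi a := ⟨max t (a + 1), lt_of_lt_of_le (lt_add_one a) (le_max_right _ _)⟩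
    have h : t ≤ t' := le_max_left t (a + 1)
    refine ⟨Module.DirectLimit.of κ (Set.Ioi a) _ _ t' (levelMap f κ r h x), Subtype.ext ?_⟩
    rw [rightArrow_of, toAll_levelMap, hx]

end Arrows

/-! ### Linear algebra of an embedded endomorphism -/

section Telescope

variable {κ : Type v} [Field κ] {V E : Type*} [AddCommGroup V] [Module κ V] [AddCommGroup E]
  [Module κ E] {α : V →ₗ[κ] V} {d : V →ₗ[κ] E} {T : E ≃ₗ[κ] E}

theorem intertwine_pow (h : ∀ v, d (α v) = T (d v)) (k : ℕ) (v : V) :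
    d ((α ^ k) v) = (T ^ k) (d v) := by
  induction k with
  | zero => rfl
  | succ k ih => rw [pow_succ', pow_succ', Module.End.mul_apply, h, ih, LinearEquiv.mul_apply]

theorem mem_core_iff (hd : Function.Injective d) (h : ∀ v, d (α v) = T (d v)) (v : V) :
    v ∈ core α ↔ ∀ k : ℕ, ∃ w, (T ^ k) (d w) = d v := by
  simp only [core, Submodule.mem_iInf, LinearMap.mem_range, ← intertwine_pow h, hd.eq_iff]

/-- The embedding of the telescope of `α` which `d` induces when `T` extends `α`. -/
def telescopeTo (h : ∀ v, d (α v) = T (d v)) : telescope α →ₗ[κ] E :=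
  Module.DirectLimit.lift κ ℕ (fun _ => V) (fun i j _ => α ^ (j - i))
    (fun k => ((T ^ k)⁻¹ : E ≃ₗ[κ] E).toLinearMap ∘ₗ d) fun i j hij x => by
      change ((T ^ j)⁻¹ : E ≃ₗ[κ] E) (d ((α ^ (j - i)) x)) = ((T ^ i)⁻¹ : E ≃ₗ[κ] E) (d x)
      rw [intertwine_pow h, ← LinearEquiv.mul_apply]
      congr 1
      obtain ⟨m, rfl⟩ := Nat.exists_eq_add_of_le hij
      rw [Nat.add_sub_cancel_left, add_comm, pow_add, mul_inv_rev, inv_mul_cancel_right]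

theorem telescopeTo_of (h : ∀ v, d (α v) = T (d v)) (k : ℕ) (v : V) :
    telescopeTo h (Module.DirectLimit.of κ ℕ (fun _ => V) (fun i j _ => α ^ (j - i)) k v) =
      ((T ^ k)⁻¹ : E ≃ₗ[κ] E) (d v) :=
  Module.DirectLimit.lift_of _ _ _

theorem telescopeTo_toTelescope (h : ∀ v, d (α v) = T (d v)) (v : V) :
    telescopeTo h (toTelescope α v) = d v := by
  refine (telescopeTo_of h 0 v).trans ?_
  rw [pow_zero, inv_one]
  rfl

theorem telescopeTo_injective (hd : Function.Injective d) (h : ∀ v, d (α v) = T (d v)) :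
    Function.Injective (telescopeTo h) :=
  Module.DirectLimit.lift_injective _ _ fun k =>
    ((T ^ k)⁻¹ : E ≃ₗ[κ] E).injective.comp hd

theorem mem_range_telescopeTo_iff (h : ∀ v, d (α v) = T (d v)) (y : E) :
    y ∈ LinearMap.range (telescopeTo h) ↔ ∃ (k : ℕ) (v : V), d v = (T ^ k) y := by
  constructor
  · rintro ⟨z, rfl⟩
    obtain ⟨k, v, rfl⟩ := Module.DirectLimit.exists_of z
    refine ⟨k, v, ?_⟩
    rw [telescopeTo_of, ← LinearEquiv.mul_apply, mul_inv_cancel]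
    rfl
  · rintro ⟨k, v, hv⟩
    refine ⟨_, (telescopeTo_of h k v).trans ?_⟩
    rw [hv, ← LinearEquiv.mul_apply, inv_mul_cancel]
    rfl

end Telescope

/-! ### The action on homology -/

section Action

variable {Γ : AddSubgroup ℝ} {X' : Type u} [TopologicalSpace X'] [AddAction Γ X']
  [hc : ContinuousConstVAdd Γ X'] {f : C(X', ℝ)} (κ : Type v) [Field κ] (r : ℕ)

theorem Hmap_translate_translate (g h : Γ) (x : H κ r X') :
    Hmap κ r (translate X' g) (Hmap κ r (translate X' h) x) = Hmap κ r (translate X' (g + h)) x := by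
  rw [← Hmap_comp_apply]
  congr 2
  ext x
  exact (add_vadd g h x).symm

theorem Hmap_translate_zero (x : H κ r X') : Hmap κ r (translate X' (0 : Γ)) x = x := by
  have : translate X' (0 : Γ) = ContinuousMap.id X' := ContinuousMap.ext fun x => zero_vadd Γ x
  rw [this]
  change (((AlgebraicTopology.singularHomologyFunctor (ModuleCat.{max u v} κ) r).obj
    (ModuleCat.of κ (ULift.{u} κ))).map (𝟙 (TopCat.of X'))).hom x = x
  rw [CategoryTheory.Functor.map_id]
  rfl

/-- The action of an element of the group on the homology of the covering. -/
def actEquiv (X' : Type u) [TopologicalSpace X'] [AddAction Γ X'] [ContinuousConstVAdd Γ X']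
    (g : Γ) : H κ r X' ≃ₗ[κ] H κ r X' :=
  { Hmap κ r (translate X' g) with
    invFun := Hmap κ r (translate X' (-g))
    left_inv := fun x => by
      change Hmap κ r (translate X' (-g)) (Hmap κ r (translate X' g) x) = x
      rw [Hmap_translate_translate, neg_add_cancel, Hmap_translate_zero]
    right_inv := fun x => by
      change Hmap κ r (translate X' g) (Hmap κ r (translate X' (-g)) x) = x
      rw [Hmap_translate_translate, add_neg_cancel, Hmap_translate_zero] }

theorem actEquiv_apply (g : Γ) (x : H κ r X') :
    actEquiv κ r X' g x = Hmap κ r (translate X' g) x := rfl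

theorem actEquiv_pow (g : Γ) (k : ℕ) : actEquiv κ r X' g ^ k = actEquiv κ r X' (k • g) := by
  induction k with
  | zero =>
    ext x
    rw [zero_nsmul, actEquiv_apply, Hmap_translate_zero]
    rfl
  | succ k ih =>
    ext x
    rw [pow_succ', ih, LinearEquiv.mul_apply, actEquiv_apply, actEquiv_apply,
      Hmap_translate_translate, succ_nsmul', actEquiv_apply]

variable {κ r}

theorem toAll_subTranslate (hf : IsLift (Γ := Γ) f) (g : Γ) (t : ℝ) (x : H κ r (Sub f t)) :
    toAll f κ r (t + g) (Hmap κ r (subTranslate f hf g t) x) =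
      actEquiv κ r X' g (toAll f κ r t x) := by
  rw [actEquiv_apply, toAll, toAll, ← Hmap_comp_apply, ← Hmap_comp_apply]
  rfl

/-- Enlarging the sublevel set does not change the class in `X'`; only the translation survives. -/
theorem toAll_shiftBack (hf : IsLift (Γ := Γ) f) (a : ℝ) (l : Γ) (hl : 0 ≤ (l : ℝ))
    (x : H κ r (Sub f a)) :
    toAll f κ r a (shiftBack hc f hf κ r a l hl x) =
      actEquiv κ r X' (-l) (toAll f κ r a x) := by
  rw [shiftBack, LinearMap.comp_apply, toAll_levelMap, toAll_subTranslate]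

theorem actEquiv_mem_img (hf : IsLift (Γ := Γ) f) (g : Γ) {t : ℝ} {y : H κ r X'}
    (hy : y ∈ img f κ r t) : actEquiv κ r X' g y ∈ img f κ r (t + g) := by
  obtain ⟨x, rfl⟩ := hy
  exact ⟨_, toAll_subTranslate hf g t x⟩

theorem actEquiv_neg_actEquiv (g : Γ) (y : H κ r X') :
    actEquiv κ r X' g (actEquiv κ r X' (-g) y) = y :=
  (actEquiv κ r X' g).apply_symm_apply y

/-- Translation by `-k • l` carries `𝕀_a` onto `𝕀_{a - kl}`, and the levels `a - kl` tend to `-∞`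
because `l > 0`. -/
theorem mem_imgBot_iff (hf : IsLift (Γ := Γ) f) (a : ℝ) {l : Γ} (hl : 0 < (l : ℝ))
    (y : H κ r X') :
    y ∈ imgBot f κ r ↔ ∀ k : ℕ, ∃ w ∈ img f κ r a, (actEquiv κ r X' (-l) ^ k) w = y := by
  refine (Submodule.mem_iInf _).trans ⟨fun h k => ?_, fun h t => ?_⟩
  · rw [actEquiv_pow, smul_neg]
    refine ⟨actEquiv κ r X' (k • l) y, ?_, (actEquiv κ r X' (k • l)).symm_apply_apply y⟩
    simpa using actEquiv_mem_img hf (k • l) (h (a - (k • l : Γ)))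
  · obtain ⟨k, hk⟩ := Archimedean.arch (a - t) hl
    obtain ⟨w, hw, rfl⟩ := h k
    rw [actEquiv_pow]
    refine img_mono f κ r ?_ (actEquiv_mem_img hf (k • (-l)) hw)
    rw [smul_neg]
    push_cast
    linarith

theorem mem_imgTop_iff (hf : IsLift (Γ := Γ) f) (a : ℝ) {l : Γ} (hl : 0 < (l : ℝ))
    (y : H κ r X') :
    y ∈ imgTop f κ r ↔ ∃ k : ℕ, (actEquiv κ r X' (-l) ^ k) y ∈ img f κ r a := by
  simp only [actEquiv_pow, smul_neg]
  refine Set.mem_iUnion.trans ⟨fun ⟨t, ht⟩ => ?_, fun ⟨k, hk⟩ => ⟨a + (k • l : Γ), ?_⟩⟩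
  · obtain ⟨k, hk⟩ := Archimedean.arch (t - a) hl
    refine ⟨k, img_mono f κ r ?_ (actEquiv_mem_img hf (-(k • l)) ht)⟩
    push_cast
    linarith
  · have := actEquiv_mem_img hf (k • l) hk
    rwa [actEquiv_neg_actEquiv] at this

end Action

/-! ### Identification with the algebraic model -/

section Model

variable {X' : Type u} [TopologicalSpace X'] {f : C(X', ℝ)} {κ : Type v} [Field κ] {r : ℕ} {a : ℝ}

/-- The projection changes `y` only by an element of the kernel. -/
theorem toAll_projectionOnto {V : Submodule κ (H κ r (Sub f a))}
    (hVW : IsCompl V (LinearMap.ker (toAll f κ r a))) (y : H κ r (Sub f a)) :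
    toAll f κ r a (V.projectionOnto _ hVW y) = toAll f κ r a y := by
  rw [← sub_eq_zero, ← map_sub, ← LinearMap.mem_ker, ← V.projectionOnto_apply_eq_zero_iff hVW,
    map_sub, Submodule.projectionOnto_apply_left, sub_self]

theorem injective_toAll_subtype {V : Submodule κ (H κ r (Sub f a))}
    (hVW : IsCompl V (LinearMap.ker (toAll f κ r a))) :
    Function.Injective (toAll f κ r a ∘ₗ V.subtype) :=
  (injective_iff_map_eq_zero _).2 fun v hv =>
    Subtype.ext ((Submodule.disjoint_def.1 hVW.disjoint) v v.2 hv)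

/-- The comparison diagram for a complement `V` of the kernel of `H_r(X'_a) → H_r(X')` and an
endomorphism of `V` which corresponds to an automorphism `T` of `H_r(X')`. -/
def modelIso {V : Submodule κ (H κ r (Sub f a))}
    (hVW : IsCompl V (LinearMap.ker (toAll f κ r a))) {α : V →ₗ[κ] V}
    {T : H κ r X' ≃ₗ[κ] H κ r X'}
    (hα : ∀ v : V, (toAll f κ r a ∘ₗ V.subtype) (α v) = T ((toAll f κ r a ∘ₗ V.subtype) v))
    (hbot : ∀ y, y ∈ imgBot f κ r ↔ ∀ k : ℕ, ∃ w ∈ img f κ r a, (T ^ k) w = y)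
    (htop : ∀ y, y ∈ imgTop f κ r ↔ ∃ k : ℕ, (T ^ k) y ∈ img f κ r a)
    (hV : LinearMap.range (invLimTo f κ r a) ≤ V)
    (hl : Function.Bijective (leftArrow f κ r a)) (hr : Function.Bijective (rightArrow f κ r a)) :
    ModelIso f κ r a V _ hVW α := by
  have hinj := injective_toAll_subtype hVW
  have himg : ∀ y, y ∈ img f κ r a ↔ ∃ v : V, (toAll f κ r a ∘ₗ V.subtype) v = y := fun y =>
    ⟨fun ⟨x, hx⟩ => ⟨V.projectionOnto _ hVW x, (toAll_projectionOnto hVW x).trans hx⟩,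
      fun ⟨v, hv⟩ => ⟨v, hv⟩⟩
  let eImg : img f κ r a ≃ₗ[κ] V :=
    (LinearEquiv.ofBijective ((toAll f κ r a ∘ₗ V.subtype).codRestrict (img f κ r a)
      fun v => (himg _).2 ⟨v, rfl⟩)
      ⟨fun v w h => hinj (congrArg Subtype.val h), fun y => by
        obtain ⟨v, hv⟩ := (himg y).1 y.2
        exact ⟨v, Subtype.ext hv⟩⟩).symm
  have heImg : ∀ y, toAll f κ r a (eImg y) = y := fun y =>
    congrArg Subtype.val (eImg.symm_apply_apply y)
  have hcore : ∀ v : V, v ∈ core α ↔ toAll f κ r a v ∈ imgBot f κ r := fun v => by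
    rw [mem_core_iff hinj hα, hbot]
    refine forall_congr' fun k => ⟨fun ⟨w, hw⟩ => ⟨_, (himg _).2 ⟨w, rfl⟩, hw⟩, ?_⟩
    rintro ⟨w, hw, h⟩
    obtain ⟨w, rfl⟩ := (himg w).1 hw
    exact ⟨w, h⟩
  let eBot : imgBot f κ r ≃ₗ[κ] core α :=
    LinearEquiv.ofBijective
      ((eImg.toLinearMap ∘ₗ Submodule.inclusion (imgBot_le f κ r a)).codRestrict (core α)
        fun y => (hcore _).2 (by
          have h := heImg (Submodule.inclusion (imgBot_le f κ r a) y)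
          change toAll f κ r a (eImg _) ∈ _
          rw [h]
          exact y.2))
      ⟨fun y z h => Submodule.inclusion_injective _ (eImg.injective (congrArg Subtype.val h)),
        fun v => ⟨⟨_, (hcore v).1 v.2⟩, Subtype.ext (eImg.symm.injective
          ((eImg.symm_apply_apply _).trans rfl))⟩⟩
  have htel : ∀ z, telescopeTo hα z ∈ imgTop f κ r := fun z => by
    obtain ⟨k, v, h⟩ := (mem_range_telescopeTo_iff hα _).1 ⟨z, rfl⟩
    exact (htop _).2 ⟨k, (himg _).2 ⟨v, h⟩⟩
  let eTop : imgTop f κ r ≃ₗ[κ] telescope α :=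
    (LinearEquiv.ofBijective ((telescopeTo hα).codRestrict (imgTop f κ r) htel)
      ⟨fun v w h => telescopeTo_injective hinj hα (congrArg Subtype.val h), fun y => by
        obtain ⟨k, hk⟩ := (htop y).1 y.2
        obtain ⟨v, hv⟩ := (himg _).1 hk
        obtain ⟨z, hz⟩ := (mem_range_telescopeTo_iff hα y).2 ⟨k, v, hv⟩
        exact ⟨z, Subtype.ext hz⟩⟩).symm
  have hmid : ∀ y, eImg (middleArrow f κ r a y) = V.projectionOnto _ hVW y := fun y =>
    hinj ((heImg _).trans (toAll_projectionOnto hVW y).symm)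
  have hlow : ∀ x, eTop (Submodule.inclusion (le_imgTop f κ r a) x) = toTelescope α (eImg x) :=
    fun x => (LinearEquiv.symm_apply_eq _).2 (Subtype.ext
      ((heImg x).symm.trans (telescopeTo_toTelescope hα (eImg x)).symm))
  refine
    -- The upper outer isomorphisms are defined through the vertical arrows, so the outer squares
    -- commute by definition.
    { eLim := (LinearEquiv.ofBijective _ hl).trans eBot
      eColim := (LinearEquiv.ofBijective _ hr).trans eTop
      eBot := eBot
      eImg := eImg
      eTop := eTop
      upper_left := fun x => ?_
      upper_right := fun y => ?_
      lower_left := fun x => rfl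
      lower_right := hlow
      left := fun x => rfl
      middle := hmid
      right := fun x => rfl }
  -- The image of the inverse limit must have no `W`-component, which is why `V` was required to
  -- contain it.
  · have hx : invLimTo f κ r a x ∈ V := hV ⟨x, rfl⟩
    have hcoe : ((eBot (leftArrow f κ r a x) : core α) : V) = ⟨invLimTo f κ r a x, hx⟩ :=
      hinj (heImg _)
    rw [LinearEquiv.symm_apply_eq, LinearEquiv.trans_apply, LinearEquiv.ofBijective_apply, hcoe,
      Submodule.coe_prodEquivOfIsCompl']
    exact (add_zero _).symm
  · change eTop (rightArrow f κ r a (toDirLim f κ r a y)) = _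
    rw [rightArrow_toDirLim, hlow, hmid]

end Model

end TopForm

end

/-! ### The comparison theorem -/

theorem theorem3p2 {κ : Type v} [Field κ] {X X' : Type u} [TopologicalSpace X] [CompactSpace X]
    (hX : TopForm.IsANR X) [TopologicalSpace X'] (ξ : TopForm.H.{u, 0} ℤ 1 X →+ ℝ)
    [AddAction ξ.range X'] (π : C(X', X)) (hπ : TopForm.IsAssociatedCovering ξ π)
    (f : C(X', ℝ)) (hf : TopForm.IsLift (Γ := ξ.range) f) (r : ℕ) (a : ℝ) :
    Function.Bijective (TopForm.leftArrow f κ r a) ∧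
    Function.Bijective (TopForm.rightArrow f κ r a) ∧
    ∀ (l : ξ.range) (hl : 0 < (l : ℝ)),
      ∃ (V W : Submodule κ (TopForm.H κ r (TopForm.Sub f a))) (hVW : IsCompl V W)
        (α : V →ₗ[κ] V),
        Function.Injective α ∧
        (∀ v : V, α v = V.projectionOnto W hVW
          (TopForm.shiftBack hπ.covering.toContinuousConstVAdd f hf κ r a l hl.le v)) ∧
        Nonempty (TopForm.ModelIso f κ r a V W hVW α) := by
  obtain ⟨N, hN, hd⟩ := TopForm.exists_diesAfter hX hπ.covering hf κ r
  have hleft := hd.leftArrow_bijective a hN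
  have hright := hd.rightArrow_bijective a hN
  refine ⟨hleft, hright, fun l hl => ?_⟩
  have hc := hπ.covering.toContinuousConstVAdd
  -- Injectivity of the left arrow leaves no non-zero element of the image of the inverse limit in
  -- the kernel, so a complement of the kernel can be chosen to contain this image.
  have hdisj : Disjoint (LinearMap.range (TopForm.invLimTo f κ r a))
      (LinearMap.ker (TopForm.toAll f κ r a)) := by
    refine Submodule.disjoint_def.2 ?_
    rintro _ ⟨x, rfl⟩ hx
    rw [hleft.1 (a₁ := x) (a₂ := 0) (Subtype.ext (by rw [map_zero]; exact hx)), map_zero]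
  obtain ⟨V, hV, hVW⟩ := hdisj.exists_isCompl
  let α : V →ₗ[κ] V := V.projectionOnto _ hVW ∘ₗ TopForm.shiftBack hc f hf κ r a l hl.le ∘ₗ V.subtype
  have hα : ∀ v : V, (TopForm.toAll f κ r a ∘ₗ V.subtype) (α v) =
      TopForm.actEquiv κ r X' (-l) ((TopForm.toAll f κ r a ∘ₗ V.subtype) v) := fun v =>
    (TopForm.toAll_projectionOnto hVW _).trans (TopForm.toAll_shiftBack hf a l hl.le (V.subtype v))
  refine ⟨V, _, hVW, α, fun v w h => ?_, fun v => rfl, ⟨TopForm.modelIso hVW hα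
    (TopForm.mem_imgBot_iff hf a hl) (TopForm.mem_imgTop_iff hf a hl) hV hleft hright⟩⟩
  -- Inside `H_r(X')` the map `α` is the restriction of the invertible action of `-l`.
  apply TopForm.injective_toAll_subtype hVW
  apply (TopForm.actEquiv κ r X' (-l)).injective
  rw [← hα, ← hα, h]
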